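/- Let $0<q<1$ and $\kappa>0$. There are constants $c,C\in(0,\infty)$ depending only on $q$ and $\kappa$ such that the following holds. Let $\Omega$ be a locally compact Hausdorff space with countable base, and let $\mathcal M^+(\Omega)$ be the class of nonnegative Radon (locally finite Borel) measures on $\Omega$. Let $G\colon\Omega\times\Omega\to(0,+\infty]$ be a quasi-metric kernel with constant $\kappa$, i.e. $G$ is lower semicontinuous on $\Omega\times\Omega$, symmetric, and $d=1/G$ satisfies $d(x,y)\le\kappa\,[d(x,z)+d(z,y)]$ for all $x,y,z\in\Omega$. Let $\sigma\in\mathcal M^+(\Omega)$, $\sigma\ne0$, and let $f\colon\Omega\to[0,+\infty]$ be Borel measurable. For a Borel measure $\nu\ge 0$ put $\mathbf G\nu(x)=\int_\Omega G(x,y)\,d\nu(y)$, so that $\mathbf G(g\,d\sigma)(x)=\int_\Omega G(x,y)\,g(y)\,d\sigma(y)$ for Borel $g\ge0$. For $x\in\Omega$, $r>0$ let $B(x,r)=\{y\in\Omega: G(x,y)>1/r\}$; for a Borel set $E$ let $\varkappa(E)\in[0,+\infty]$ be the least constant in $$\Big(\int_E(\mathbf G\nu)^q\,d\sigma\Big)^{1/q}\le\varkappa(E)\,\nu(\Omega)\qquad\text{for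 all }\nu\in\mathcal M^+(\Omega),$$ and put $$\mathbf K\sigma(x)=\int_0^\infty\frac{[\varkappa(B(x,r))]^{\frac q{1-q}}}{r^2}\,dr .$$ For the equation $u=\mathbf G(u^q\,d\sigma)+f$, a Borel measurable function $u\colon\Omega\to[0,+\infty]$ is called a nontrivial supersolution if $u>0$ and $\mathbf G(u^q\,d\sigma)+f\le u<\infty$ $d\sigma$-a.e.; a subsolution if $u\le\mathbf G(u^q\,d\sigma)+f<\infty$ $d\sigma$-a.e.; and a nontrivial solution if it is both a nontrivial supersolution and a subsolution. Consider the estimates $$c\,\big[(\mathbf G\sigma)^{\frac1{1-q}}+\mathbf K\sigma+\mathbf G(f^q\,d\sigma)\big]+f\le u\quad d\sigma\text{-a.e.},\tag{L}$$ $$u\le C\,\big[(\mathbf G\sigma)^{\frac1{1-q}}+\mathbf K\sigma+\mathbf G(f^q\,d\sigma)\big]+f\quad d\sigma\text{-a.e.}\tag{U}$$ (i) Any two nontrivial solutions coincide $d\sigma$-a.e., and every nontrivial solution $u$ satisfies (L) and (U). (ii) Every nontrivial supersolution satisfies (L), and every subsolution satisfies (U). (iii) A nontrivial solution exists if and only if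 $\mathbf G\sigma<\infty$, $\mathbf K\sigma<\infty$, $f<\infty$ and $\mathbf G(f^q\,d\sigma)<\infty$ $d\sigma$-a.e. -/

import Mathlib

open MeasureTheory Set
open scoped ENNReal NNReal

namespace SublinearPotential

section Kernels

variable {Ω : Type*}

/-- A kernel `G : Ω × Ω → (0, +∞]`: positive and lower semicontinuous on `Ω × Ω`. -/
structure IsKernel [TopologicalSpace Ω] (G : Ω → Ω → ℝ≥0∞) : Prop where
  pos : ∀ x y, 0 < G x y
  lsc : LowerSemicontinuous (fun p : Ω × Ω => G p.1 p.2)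

/-- A quasi-metric kernel with quasi-metric constant `κ`: a symmetric kernel such that
`d = 1 / G` (which has values in `[0, +∞)`, because `G > 0`) satisfies the quasi-triangle
inequality. -/
structure IsQuasiMetricKernel [TopologicalSpace Ω] (G : Ω → Ω → ℝ≥0∞) (κ : ℝ≥0) : Prop
    extends IsKernel G where
  symm : ∀ x y, G x y = G y x
  quasi_triangle : ∀ x y z, (G x y)⁻¹ ≤ (κ : ℝ≥0∞) * ((G x z)⁻¹ + (G z y)⁻¹)

/-- The ball `B(x, r) = {y : G(x, y) > 1 / r}`, used for `r > 0`. -/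
def kernelBall (G : Ω → Ω → ℝ≥0∞) (x : Ω) (r : ℝ) : Set Ω :=
  {y | ENNReal.ofReal (1 / r) < G x y}

/-- The linear potential `𝐆ν(x) = ∫ G(x, y) dν(y)`. -/
noncomputable def potential [MeasurableSpace Ω] (G : Ω → Ω → ℝ≥0∞) (ν : Measure Ω) (x : Ω) :
    ℝ≥0∞ :=
  ∫⁻ y, G x y ∂ν

/-- The potential `𝐆(g ^ q dσ)` of the measure with density `g ^ q` with respect to `σ`. -/
noncomputable def powPotential [MeasurableSpace Ω] (G : Ω → Ω → ℝ≥0∞) (q : ℝ) (σ : Measure Ω)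
    (g : Ω → ℝ≥0∞) : Ω → ℝ≥0∞ :=
  potential G (σ.withDensity fun y => g y ^ q)

/-- `ϰ(E) = ϰ(E, σ)`: the least constant `C ∈ [0, +∞]` in the `(1, q)`-type inequality
`‖𝐆ν‖_{L^q(Ω, σ_E)} ≤ C ‖ν‖` for all `ν ∈ 𝓜⁺(Ω)`. -/
noncomputable def leastConst [TopologicalSpace Ω] [MeasurableSpace Ω] (G : Ω → Ω → ℝ≥0∞) (q : ℝ)
    (σ : Measure Ω) (E : Set Ω) : ℝ≥0∞ :=
  sInf {C : ℝ≥0∞ | ∀ ν : Measure Ω, IsLocallyFiniteMeasure ν →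
    (∫⁻ x in E, potential G ν x ^ q ∂σ) ^ (1 / q) ≤ C * ν univ}

/-- The nonlinear potential `𝐊σ(x) = ∫₀^∞ ϰ(B(x, r)) ^ (q / (1 - q)) / r² dr`. -/
noncomputable def nonlinearPotential [TopologicalSpace Ω] [MeasurableSpace Ω]
    (G : Ω → Ω → ℝ≥0∞) (q : ℝ) (σ : Measure Ω) (x : Ω) : ℝ≥0∞ :=
  ∫⁻ r in Ioi (0 : ℝ),
    leastConst G q σ (kernelBall G x r) ^ (q / (1 - q)) / ENNReal.ofReal (r ^ 2)

variable [MeasurableSpace Ω]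

/-- Nontrivial supersolution of `u = 𝐆(u ^ q dσ) + f`. -/
structure IsNontrivialSupersolution (G : Ω → Ω → ℝ≥0∞) (q : ℝ) (σ : Measure Ω)
    (f u : Ω → ℝ≥0∞) : Prop where
  measurable : Measurable u
  pos : ∀ᵐ x ∂σ, 0 < u x
  le : ∀ᵐ x ∂σ, powPotential G q σ u x + f x ≤ u x
  lt_top : ∀ᵐ x ∂σ, u x < ∞

/-- Subsolution of `u = 𝐆(u ^ q dσ) + f`. -/
structure IsSubsolution (G : Ω → Ω → ℝ≥0∞) (q : ℝ) (σ : Measure Ω)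
    (f u : Ω → ℝ≥0∞) : Prop where
  measurable : Measurable u
  le : ∀ᵐ x ∂σ, u x ≤ powPotential G q σ u x + f x
  lt_top : ∀ᵐ x ∂σ, powPotential G q σ u x + f x < ∞

/-- Nontrivial solution of `u = 𝐆(u ^ q dσ) + f`: a function which is both a nontrivial
supersolution and a subsolution, i.e. the equation holds and `0 < u < ∞`, `dσ`-a.e. -/
def IsNontrivialSolution (G : Ω → Ω → ℝ≥0∞) (q : ℝ) (σ : Measure Ω)
    (f u : Ω → ℝ≥0∞) : Prop :=
  IsNontrivialSupersolution G q σ f u ∧ IsSubsolution G q σ f u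

/-- The function `(𝐆σ) ^ (1 / (1 - q)) + 𝐊σ + 𝐆(f ^ q dσ)`. -/
noncomputable def boundFun [TopologicalSpace Ω] (G : Ω → Ω → ℝ≥0∞) (q : ℝ) (σ : Measure Ω)
    (f : Ω → ℝ≥0∞) (x : Ω) : ℝ≥0∞ :=
  potential G σ x ^ (1 / (1 - q)) + nonlinearPotential G q σ x + powPotential G q σ f x

/-- The lower bound `c [(𝐆σ) ^ (1 / (1 - q)) + 𝐊σ + 𝐆(f ^ q dσ)] + f ≤ u`, `dσ`-a.e. -/
def LowerBound [TopologicalSpace Ω] (G : Ω → Ω → ℝ≥0∞) (q : ℝ) (σ : Measure Ω)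
    (f u : Ω → ℝ≥0∞) (c : ℝ≥0) : Prop :=
  ∀ᵐ x ∂σ, (c : ℝ≥0∞) * boundFun G q σ f x + f x ≤ u x

/-- The upper bound `u ≤ C [(𝐆σ) ^ (1 / (1 - q)) + 𝐊σ + 𝐆(f ^ q dσ)] + f`, `dσ`-a.e. -/
def UpperBound [TopologicalSpace Ω] (G : Ω → Ω → ℝ≥0∞) (q : ℝ) (σ : Measure Ω)
    (f u : Ω → ℝ≥0∞) (C : ℝ≥0) : Prop :=
  ∀ᵐ x ∂σ, u x ≤ (C : ℝ≥0∞) * boundFun G q σ f x + f x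

end Kernels

end SublinearPotential

open SublinearPotential

/-! Write `μ = u ^ q dσ`. Everything compares `𝐆μ(x)` with `boundFun` at `x`, up to constants
depending only on `q` and `κ`, through the formula `𝐆ν(x) = ∫ ν(B(x, r)) / r² dr`.

Lower bound, where `𝐆μ ≤ u`. For fixed `x`, the quasi-triangle inequality gives `∫ min (G x z) (G x
y) dμ(z) ≤ 2κ 𝐆μ(y) ≤ 2κ u(y)`. The reciprocal of the left side is of weak type `(1, 1)` for the
measure `G(x, ·) dμ`, whose mass is `𝐆μ(x)`, so integrating its `q`-th power bounds `𝐆σ(x)`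
(`potential_le_of_supersolution`). A Vitali covering makes `ν ↦ 𝐆ν / 𝐆μ` of weak type `(1, 1)`
(`weak_type`), hence `ϰ(E) ^ (q / (1 - q)) ≲ μ(E)`; taking balls and integrating in `r` bounds `𝐊σ`
(`nonlinearPotential_le`).

Upper bound, where `u ≤ 𝐆μ + f`. On `B(x, r)` the part of `μ` outside `B(x, 2κr)` contributes at
most `2κ 𝐆μ(x)`, and the near part is controlled by `ϰ`. Young's inequality and integration in `r`
leave a small multiple of `𝐆μ(x)`, absorbed when this value is finite (`powPotential_le_boundFun`).

Uniqueness: the two bounds give `u ≤ a v` for a subsolution `u` and a supersolution `v`, and the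
sublinear power drives `a` to `1` (`le_of_le_const_mul`). Existence: truncated Picard iterates
increase from a small positive subsolution, and the upper bound keeps their limit finite
(`exists_solution`). -/

namespace SublinearPotential

/-! ### Layer formulas, weak type estimates and Young's inequality. -/

section Scalar

theorem lintegral_Ioi_inv_sq {a : ℝ} (ha : 0 < a) :
    ∫⁻ r in Ioi a, (ENNReal.ofReal (r ^ 2))⁻¹ = ENNReal.ofReal (1 / a) := by
  have h1 : ∫⁻ r in Ioi a, (ENNReal.ofReal (r ^ 2))⁻¹
      = ∫⁻ r in Ioi a, ENNReal.ofReal (r ^ (-2 : ℝ)) := by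
    refine setLIntegral_congr_fun measurableSet_Ioi fun r hr => ?_
    have hr0 : 0 < r := ha.trans hr
    rw [← ENNReal.ofReal_inv_of_pos (by positivity), Real.rpow_neg hr0.le]
    norm_num
  rw [h1, ← ofReal_integral_eq_lintegral_ofReal
    (integrableOn_Ioi_rpow_of_lt (by norm_num) ha)]
  · rw [integral_Ioi_rpow_of_lt (by norm_num) ha]
    congr 1
    rw [show (-2 : ℝ) + 1 = -1 by norm_num, Real.rpow_neg_one]
    field_simp
  · filter_upwards [ae_restrict_mem measurableSet_Ioi] with r hr
    exact Real.rpow_nonneg (ha.trans hr).le _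

/-- The indicator cuts the half-line at `r = 1 / g`, and `∫ dr / r²` beyond that point is `g`. The
value `g = ∞` is reached through finite `c < g`. -/
theorem lintegral_Ioi_layer (g : ℝ≥0∞) :
    ∫⁻ r in Ioi (0 : ℝ), {r | ENNReal.ofReal (1 / r) < g}.indicator
      (fun r => (ENNReal.ofReal (r ^ 2))⁻¹) r = g := by
  have hmeas : MeasurableSet {r : ℝ | ENNReal.ofReal (1 / r) < g} :=
    measurableSet_lt (by fun_prop) measurable_const
  rw [lintegral_indicator hmeas, Measure.restrict_restrict hmeas]
  rcases eq_or_ne g 0 with rfl | h0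
  · simp
  have key : ∀ a : ℝ, 0 < a → ENNReal.ofReal (1 / a) ≤ g →
      ENNReal.ofReal (1 / a) ≤ ∫⁻ r in {r | ENNReal.ofReal (1 / r) < g} ∩ Ioi 0,
        (ENNReal.ofReal (r ^ 2))⁻¹ := by
    intro a ha hag
    rw [← lintegral_Ioi_inv_sq ha]
    refine lintegral_mono_set fun r hr => ⟨?_, ha.trans hr⟩
    refine lt_of_lt_of_le ?_ hag
    exact (ENNReal.ofReal_lt_ofReal_iff (by positivity)).2 (one_div_lt_one_div_of_lt ha hr)
  refine le_antisymm ?_ (le_of_forall_lt fun b hb => ?_)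
  · rcases eq_or_ne g ∞ with rfl | h1
    · exact le_top
    · have hg : 0 < g.toReal := ENNReal.toReal_pos h0 h1
      calc _ ≤ ∫⁻ r in Ioi (1 / g.toReal), (ENNReal.ofReal (r ^ 2))⁻¹ := by
            refine lintegral_mono_set fun r hr => ?_
            have h2 := hr.1
            have hr0 : 0 < r := hr.2
            simp only [mem_ofPred_eq] at h2
            rw [ENNReal.ofReal_lt_iff_lt_toReal (by positivity) h1] at h2
            exact (one_div_lt hr0 hg).1 h2
        _ = g := by
            rw [lintegral_Ioi_inv_sq (by positivity), one_div_one_div, ENNReal.ofReal_toReal h1]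
  · obtain ⟨c, hbc, hcg⟩ := exists_between hb
    have hc1 : c ≠ ∞ := hcg.ne_top
    have hc : 0 < c.toReal := ENNReal.toReal_pos (ne_bot_of_gt hbc) hc1
    have := key (1 / c.toReal) (by positivity)
      (by rw [one_div_one_div, ENNReal.ofReal_toReal hc1]; exact hcg.le)
    rw [one_div_one_div, ENNReal.ofReal_toReal hc1] at this
    exact hbc.trans_le this

/-- The constant in `lintegral_rpow_le_of_weak`. -/
noncomputable def weakConst (q : ℝ) : ℝ≥0∞ :=
  1 + ∑' k : ℕ, ((2 : ℝ≥0∞) ^ (k + 1)) ^ q / 2 ^ k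

theorem weakConst_ne_zero (q : ℝ) : weakConst q ≠ 0 := by
  simp [weakConst]

theorem weakConst_ne_top {q : ℝ} (hq1 : q < 1) : weakConst q ≠ ∞ := by
  have h : ∀ k : ℕ, ((2 : ℝ≥0∞) ^ (k + 1)) ^ q / 2 ^ k = 2 ^ q * ((2 : ℝ≥0∞) ^ (q - 1)) ^ k := by
    intro k
    rw [← ENNReal.rpow_natCast, ← ENNReal.rpow_natCast, ← ENNReal.rpow_natCast,
      ← ENNReal.rpow_mul, ← ENNReal.rpow_mul, ← ENNReal.rpow_sub _ _ (by simp) (by simp),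
      ← ENNReal.rpow_add _ _ (by simp) (by simp)]
    congr 1
    push_cast
    ring
  rw [weakConst]
  refine ENNReal.add_ne_top.2 ⟨by simp, ?_⟩
  simp_rw [h]
  rw [ENNReal.tsum_mul_left, ENNReal.tsum_geometric]
  refine ENNReal.mul_ne_top (by simp) (ENNReal.inv_ne_top.2 ?_)
  have : (2 : ℝ≥0∞) ^ (q - 1) < 1 :=
    ENNReal.rpow_lt_one_of_one_lt_of_neg (by norm_num) (by linarith)
  exact (tsub_pos_of_lt this).ne'

/-- A finite `h > T` lies in one dyadic interval `(2 ^ k T, 2 ^ (k + 1) T]`, and that single term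
suffices. For `h = ∞` every term is at least `T ^ q`, so the series diverges. -/
theorem rpow_le_dyadic_sum {q : ℝ} (hq0 : 0 < q) (h T : ℝ≥0∞) (hT0 : T ≠ 0) (hT : T ≠ ∞) :
    h ^ q ≤ T ^ q + ∑' k : ℕ, (if 2 ^ k * T < h then (2 ^ (k + 1) * T) ^ q else 0) := by
  rcases le_or_gt h T with hle | hlt
  · exact (ENNReal.rpow_le_rpow hle hq0.le).trans le_self_add
  rcases eq_or_ne h ∞ with rfl | hh
  · refine le_trans le_top (le_trans ?_ le_add_self)
    rw [top_le_iff, eq_top_iff]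
    calc ∞ = ∑' _ : ℕ, T ^ q := by
          rw [ENNReal.tsum_const_eq_top_of_ne_zero]
          simp [hT0, hT]
      _ ≤ _ := by
          refine ENNReal.tsum_le_tsum fun k => ?_
          rw [if_pos (ENNReal.mul_lt_top (by simp) hT.lt_top)]
          refine ENNReal.rpow_le_rpow ?_ hq0.le
          exact le_mul_of_one_le_left zero_le (one_le_pow₀ (by norm_num))
  · have hex : ∃ n : ℕ, h ≤ 2 ^ n * T := by
      obtain ⟨n, hn⟩ := ENNReal.exists_nat_gt (ENNReal.div_ne_top hh hT0)
      refine ⟨n, ?_⟩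
      rw [← ENNReal.div_le_iff hT0 hT]
      refine hn.le.trans ?_
      exact_mod_cast (Nat.lt_two_pow_self (n := n)).le
    classical
    obtain ⟨k, hk⟩ : ∃ k, Nat.find hex = k + 1 := by
      refine Nat.exists_eq_succ_of_ne_zero fun h0 => ?_
      have := Nat.find_spec hex
      rw [h0, pow_zero, one_mul] at this
      exact absurd this (not_le.2 hlt)
    have h1 := Nat.find_spec hex
    rw [hk] at h1
    have h2 : 2 ^ k * T < h := not_le.1 (Nat.find_min hex (m := k) (by omega))
    refine le_trans ?_ le_add_self
    refine le_trans ?_ (ENNReal.le_tsum k)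
    rw [if_pos h2]
    exact ENNReal.rpow_le_rpow h1 hq0.le

variable {α : Type*} [MeasurableSpace α]

/-- A weak type `(1, 1)` bound on a space of mass `M` implies a bound in `L ^ q` for `q < 1`. -/
theorem lintegral_rpow_le_of_weak {q : ℝ} (hq0 : 0 < q) (hq1 : q < 1) (m : Measure α)
    {h : α → ℝ≥0∞} (hh : Measurable h) (a : ℝ≥0∞)
    (H : ∀ t : ℝ≥0∞, t ≠ 0 → t ≠ ∞ → m {x | t < h x} ≤ a / t) :
    ∫⁻ x, h x ^ q ∂m ≤ weakConst q * (m univ ^ (1 - q) * a ^ q) := by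
  rcases eq_or_ne (m univ) 0 with hM0 | hM0
  · simp [Measure.measure_univ_eq_zero.1 hM0]
  rcases eq_or_ne a 0 with rfl | ha0
  · have hz : ∀ᵐ x ∂m, h x = 0 := by
      have : {x | ¬ h x = 0} ⊆ ⋃ n : ℕ, {x | ((n + 1 : ℕ) : ℝ≥0∞)⁻¹ < h x} := by
        intro x hx
        obtain ⟨n, hn⟩ := ENNReal.exists_inv_nat_lt (a := h x) hx
        refine mem_iUnion.2 ⟨n, lt_of_le_of_lt ?_ hn⟩
        exact ENNReal.inv_le_inv.2 (by exact_mod_cast Nat.le_succ n)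
      refine measure_mono_null this (measure_iUnion_null fun n => ?_)
      have := H ((n + 1 : ℕ) : ℝ≥0∞)⁻¹ (by simp) (by simp)
      simpa using this
    rw [lintegral_congr_ae (g := fun _ => 0)]
    · simp
    · filter_upwards [hz] with x hx
      simp [hx, hq0]
  have hcpos : 0 < 1 - q := by linarith
  rcases eq_or_ne a ∞ with rfl | ha
  · rw [ENNReal.top_rpow_of_pos hq0, ENNReal.mul_top, ENNReal.mul_top (weakConst_ne_zero q)]
    · exact le_top
    · simp [hM0, hcpos, hq1.le]
  rcases eq_or_ne (m univ) ∞ with hM | hM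
  · rw [hM, ENNReal.top_rpow_of_pos hcpos, ENNReal.top_mul,
      ENNReal.mul_top (weakConst_ne_zero q)]
    · exact le_top
    · simp [ha0, hq0, hq0.le]
  set M := m univ with hMdef
  -- The level at which the weak bound `a / t` equals the trivial bound `M`.
  set T := a / M with hTdef
  have hT0 : T ≠ 0 := ENNReal.div_ne_zero.2 ⟨ha0, hM⟩
  have hT : T ≠ ∞ := ENNReal.div_ne_top ha hM0
  have hTM : T ^ q * M = M ^ (1 - q) * a ^ q := by
    rw [hTdef, ENNReal.div_rpow_of_nonneg _ _ hq0.le, ENNReal.rpow_sub _ _ hM0 hM,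
      ENNReal.rpow_one, div_eq_mul_inv, div_eq_mul_inv]
    ring
  have hterm : ∀ k : ℕ, (2 ^ (k + 1) * T) ^ q * m {x | 2 ^ k * T < h x}
      ≤ (((2 : ℝ≥0∞) ^ (k + 1)) ^ q / 2 ^ k) * (T ^ q * M) := by
    intro k
    have h1 := H (2 ^ k * T) (mul_ne_zero (by simp) hT0) (ENNReal.mul_ne_top (by simp) hT)
    have h2 : a / (2 ^ k * T) = M / 2 ^ k := by
      rw [hTdef, div_eq_mul_inv, div_eq_mul_inv, div_eq_mul_inv,
        ENNReal.mul_inv (Or.inl (by simp)) (Or.inl (by simp)),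
        ENNReal.mul_inv (Or.inl ha0) (Or.inl ha), inv_inv]
      calc a * ((2 ^ k)⁻¹ * (a⁻¹ * M)) = (a * a⁻¹) * (M * (2 ^ k)⁻¹) := by ring
        _ = _ := by rw [ENNReal.mul_inv_cancel ha0 ha, one_mul]
    rw [h2] at h1
    calc _ ≤ (2 ^ (k + 1) * T) ^ q * (M / 2 ^ k) := by gcongr
      _ = _ := by
        rw [ENNReal.mul_rpow_of_nonneg _ _ hq0.le, div_eq_mul_inv, div_eq_mul_inv]
        ring
  calc ∫⁻ x, h x ^ q ∂m
      ≤ ∫⁻ x, (T ^ q + ∑' k : ℕ, (if 2 ^ k * T < h x then (2 ^ (k + 1) * T) ^ q else 0)) ∂m :=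
        lintegral_mono fun x => rpow_le_dyadic_sum hq0 (h x) T hT0 hT
    _ = T ^ q * M + ∑' k : ℕ, (2 ^ (k + 1) * T) ^ q * m {x | 2 ^ k * T < h x} := by
        rw [lintegral_add_left measurable_const, lintegral_const, lintegral_tsum]
        · congr 1
          refine tsum_congr fun k => ?_
          have hs : MeasurableSet {x | 2 ^ k * T < h x} := measurableSet_lt measurable_const hh
          rw [← lintegral_indicator_const hs]
          refine lintegral_congr fun x => ?_
          simp [indicator]
        · intro k
          exact (Measurable.ite (measurableSet_lt measurable_const hh) measurable_const
            measurable_const).aemeasurable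
    _ ≤ T ^ q * M + ∑' k : ℕ, (((2 : ℝ≥0∞) ^ (k + 1)) ^ q / 2 ^ k) * (T ^ q * M) := by
        exact add_le_add le_rfl (ENNReal.tsum_le_tsum hterm)
    _ = _ := by
        rw [ENNReal.tsum_mul_right, hTM, weakConst]
        ring

/-- The truncated integral `y ↦ ∫ min (g z) (g y) dμ(z)`. -/
noncomputable def truncIntegral (μ : Measure α) (g : α → ℝ≥0∞) (y : α) : ℝ≥0∞ :=
  ∫⁻ z, min (g z) (g y) ∂μ

theorem measurable_truncIntegral (μ : Measure α) [SFinite μ] {g : α → ℝ≥0∞} (hg : Measurable g) :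
    Measurable (truncIntegral μ g) := by
  have : Measurable (fun p : α × α => min (g p.2) (g p.1)) := by fun_prop
  exact this.lintegral_prod_right'

/-- On the set, `g` is at most its supremum `L` there, so it is enough that `∫ min g L dμ ≤ a`. As
`L` need not be attained, approximate it by values `g y` with `y` in the set and apply Fatou. -/
theorem setLIntegral_truncIntegral_le (μ : Measure α) [SFinite μ] {g : α → ℝ≥0∞}
    (hg : Measurable g) (a : ℝ≥0∞) :
    ∫⁻ y in {y | truncIntegral μ g y ≤ a}, g y ∂μ ≤ a := by
  set S := {y | truncIntegral μ g y ≤ a} with hS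
  have hSm : MeasurableSet S := measurableSet_le (measurable_truncIntegral μ hg) measurable_const
  rcases S.eq_empty_or_nonempty with h | hne
  · simp [h]
  obtain ⟨v, -, hv, hvS⟩ := exists_seq_tendsto_sSup (hne.image g) (OrderTop.bddAbove _)
  set L := sSup (g '' S)
  calc ∫⁻ y in S, g y ∂μ = ∫⁻ y in S, min (g y) L ∂μ := by
        refine setLIntegral_congr_fun hSm fun y hy => ?_
        exact (min_eq_left (le_sSup (mem_image_of_mem g hy))).symm
    _ ≤ ∫⁻ y, min (g y) L ∂μ := setLIntegral_le_lintegral _ _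
    _ = ∫⁻ y, Filter.liminf (fun n => min (g y) (v n)) Filter.atTop ∂μ := by
        refine lintegral_congr fun y => ?_
        exact ((tendsto_const_nhds.min hv).liminf_eq).symm
    _ ≤ Filter.liminf (fun n => ∫⁻ y, min (g y) (v n) ∂μ) Filter.atTop :=
        lintegral_liminf_le fun n => hg.min measurable_const
    _ ≤ a := by
        refine Filter.liminf_le_of_le (by isBoundedDefault) fun b hb => ?_
        obtain ⟨n, hn⟩ := hb.exists
        obtain ⟨y, hy, hyv⟩ := hvS n
        refine hn.trans ?_
        rw [← hyv]
        exact hy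

/-- Whichever of `a` and `δ m` is larger, one term on the right dominates alone. The free `δ` later
makes the coefficient of `m` small enough to absorb. -/
theorem young_rpow {q : ℝ} (hq0 : 0 < q) (hq1 : q < 1) {δ : ℝ≥0∞} (hδ0 : δ ≠ 0) (hδ : δ ≠ ∞)
    (a m : ℝ≥0∞) :
    a ^ (1 - q) * m ^ q ≤ δ ^ (1 - q) * m + (δ ^ q)⁻¹ * a := by
  have h1q : 0 < 1 - q := by linarith
  have split : ∀ b : ℝ≥0∞, b ^ (1 - q) * b ^ q = b := fun b => by
    rw [← ENNReal.rpow_add_of_nonneg _ _ h1q.le hq0.le]; simp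
  rcases le_total a (δ * m) with h | h
  · refine le_trans ?_ le_self_add
    calc a ^ (1 - q) * m ^ q ≤ (δ * m) ^ (1 - q) * m ^ q := by gcongr
      _ = δ ^ (1 - q) * (m ^ (1 - q) * m ^ q) := by
        rw [ENNReal.mul_rpow_of_nonneg _ _ h1q.le]; ring
      _ = _ := by rw [split]
  · refine le_trans ?_ le_add_self
    have h2 : m ≤ δ⁻¹ * a := by
      rw [mul_comm, ← div_eq_mul_inv, ENNReal.le_div_iff_mul_le (Or.inl hδ0) (Or.inl hδ), mul_comm]
      exact h
    calc a ^ (1 - q) * m ^ q ≤ a ^ (1 - q) * (δ⁻¹ * a) ^ q := by gcongr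
      _ = (δ⁻¹) ^ q * (a ^ (1 - q) * a ^ q) := by
        rw [ENNReal.mul_rpow_of_nonneg _ _ hq0.le]; ring
      _ = _ := by rw [split, ENNReal.inv_rpow]

end Scalar

end SublinearPotential

namespace SublinearPotential

/-! ### Balls of a quasi-metric kernel and pointwise estimates for linear potentials. -/

section Kernel

variable {Ω : Type*} {G : Ω → Ω → ℝ≥0∞} {κ : ℝ≥0}

theorem mem_kernelBall {x y : Ω} {r : ℝ} (hr : 0 < r) :
    y ∈ kernelBall G x r ↔ (G x y)⁻¹ < ENNReal.ofReal r := by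
  rw [kernelBall, mem_ofPred_eq, one_div, ENNReal.ofReal_inv_of_pos hr, ENNReal.inv_lt_iff_inv_lt]

theorem kernelBall_subset {x : Ω} {r s : ℝ} (hr : 0 < r) (hrs : r ≤ s) :
    kernelBall G x r ⊆ kernelBall G x s := fun _ hy =>
  (mem_kernelBall (hr.trans_le hrs)).2
    (((mem_kernelBall hr).1 hy).trans_le (ENNReal.ofReal_le_ofReal hrs))

theorem lintegral_measure_layer [MeasurableSpace Ω] (ν : Measure Ω) [SFinite ν] {g : Ω → ℝ≥0∞}
    (hg : Measurable g) :
    ∫⁻ r in Ioi (0 : ℝ), ν {y | ENNReal.ofReal (1 / r) < g y} / ENNReal.ofReal (r ^ 2)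
      = ∫⁻ y, g y ∂ν := by
  have hm : ∀ r : ℝ, MeasurableSet {y | ENNReal.ofReal (1 / r) < g y} := fun r =>
    measurableSet_lt measurable_const hg
  calc _ = ∫⁻ r in Ioi (0 : ℝ), ∫⁻ y, ({r | ENNReal.ofReal (1 / r) < g y}.indicator
      (fun r => (ENNReal.ofReal (r ^ 2))⁻¹) r) ∂ν := by
        refine lintegral_congr fun r => ?_
        rw [div_eq_mul_inv, mul_comm, ← lintegral_indicator_const (hm r)]
        rfl
    _ = ∫⁻ y, (∫⁻ r in Ioi (0 : ℝ), {r | ENNReal.ofReal (1 / r) < g y}.indicator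
      (fun r => (ENNReal.ofReal (r ^ 2))⁻¹) r) ∂ν := by
        refine lintegral_lintegral_swap (Measurable.aemeasurable ?_)
        have hs : MeasurableSet {p : ℝ × Ω | ENNReal.ofReal (1 / p.1) < g p.2} :=
          measurableSet_lt (by fun_prop) (by fun_prop)
        have : Measurable ({p : ℝ × Ω | ENNReal.ofReal (1 / p.1) < g p.2}.indicator
            fun p => (ENNReal.ofReal (p.1 ^ 2))⁻¹) :=
          Measurable.indicator (by fun_prop) hs
        exact this
    _ = _ := lintegral_congr fun y => lintegral_Ioi_layer (g y)

/-- Dilating the balls by `A` is the same as multiplying the kernel by `A`. -/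
theorem lintegral_kernelBall_mul [MeasurableSpace Ω] (ν : Measure Ω) [SFinite ν] {x : Ω}
    (hG : Measurable (G x)) {A : ℝ} (hA : 0 < A) :
    ∫⁻ r in Ioi (0 : ℝ), ν (kernelBall G x (A * r)) / ENNReal.ofReal (r ^ 2)
      = ENNReal.ofReal A * potential G ν x := by
  have hA0 : ENNReal.ofReal A ≠ 0 := (ENNReal.ofReal_pos.2 hA).ne'
  rw [potential, ← lintegral_const_mul _ hG, ← lintegral_measure_layer ν (hG.const_mul _)]
  refine setLIntegral_congr_fun measurableSet_Ioi fun r hr => ?_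
  have hr0 : (0 : ℝ) < r := hr
  congr 2
  ext y
  rw [kernelBall, mem_ofPred_eq, mem_ofPred_eq, show 1 / (A * r) = 1 / r / A by field_simp,
    ENNReal.ofReal_div_of_pos hA,
    ENNReal.div_lt_iff (Or.inl hA0) (Or.inl ENNReal.ofReal_ne_top), mul_comm]

theorem lintegral_kernelBall [MeasurableSpace Ω] (ν : Measure Ω) [SFinite ν] {x : Ω}
    (hG : Measurable (G x)) :
    ∫⁻ r in Ioi (0 : ℝ), ν (kernelBall G x r) / ENNReal.ofReal (r ^ 2) = potential G ν x := by
  simpa using lintegral_kernelBall_mul ν hG one_pos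

theorem measurable_measure_kernelBall [MeasurableSpace Ω] (ν : Measure Ω) [SFinite ν] {x : Ω}
    (hG : Measurable (G x)) (A : ℝ) :
    Measurable fun r : ℝ => ν (kernelBall G x (A * r)) / ENNReal.ofReal (r ^ 2) := by
  refine Measurable.div ?_ (by fun_prop)
  have hs : MeasurableSet {p : ℝ × Ω | ENNReal.ofReal (1 / (A * p.1)) < G x p.2} :=
    measurableSet_lt (by fun_prop) (by fun_prop)
  exact measurable_measure_prodMk_left hs

theorem IsKernel.measurable [TopologicalSpace Ω] [SecondCountableTopology Ω] [MeasurableSpace Ω]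
    [BorelSpace Ω] (hG : IsKernel G) : Measurable (fun p : Ω × Ω => G p.1 p.2) :=
  hG.lsc.measurable

theorem IsKernel.measurable_apply [TopologicalSpace Ω] [SecondCountableTopology Ω]
    [MeasurableSpace Ω] [BorelSpace Ω] (hG : IsKernel G) (x : Ω) : Measurable (G x) :=
  hG.measurable.comp measurable_prodMk_left

theorem IsKernel.measurable_potential [TopologicalSpace Ω] [SecondCountableTopology Ω]
    [MeasurableSpace Ω] [BorelSpace Ω] (hG : IsKernel G) (ν : Measure Ω) [SFinite ν] :
    Measurable (potential G ν) :=
  hG.measurable.lintegral_prod_right'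

theorem IsKernel.isOpen_kernelBall [TopologicalSpace Ω] (hG : IsKernel G) (x : Ω) (r : ℝ) :
    IsOpen (kernelBall G x r) :=
  (hG.lsc.isOpen_preimage (ENNReal.ofReal (1 / r))).preimage (Continuous.prodMk_right x)

theorem potential_mono [MeasurableSpace Ω] {ν ν' : Measure Ω} (h : ν ≤ ν')
    (x : Ω) : potential G ν x ≤ potential G ν' x :=
  lintegral_mono' h le_rfl

theorem IsKernel.powPotential_apply [TopologicalSpace Ω] [SecondCountableTopology Ω]
    [MeasurableSpace Ω] [BorelSpace Ω] (hG : IsKernel G) {q : ℝ} (σ : Measure Ω)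
    {g : Ω → ℝ≥0∞} (hg : Measurable g) (x : Ω) :
    powPotential G q σ g x = ∫⁻ y, G x y * g y ^ q ∂σ := by
  rw [powPotential, potential, lintegral_withDensity_eq_lintegral_mul _ (hg.pow_const q)
    (hG.measurable_apply x)]
  simp [mul_comm]

variable [TopologicalSpace Ω]

/-- The quasi-triangle inequality through `x`, with both distances replaced by the larger one. -/
theorem IsQuasiMetricKernel.min_le (hG : IsQuasiMetricKernel G κ) (hκ : 0 < κ) (x y z : Ω) :
    min (G x y) (G x z) ≤ 2 * κ * G y z := by
  set m := min (G x y) (G x z) with hm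
  have h1 : (G y z)⁻¹ ≤ 2 * κ * m⁻¹ := by
    refine (hG.quasi_triangle y z x).trans ?_
    rw [hG.symm y x]
    have h2 : (G x y)⁻¹ ≤ m⁻¹ := ENNReal.inv_le_inv.2 (min_le_left _ _)
    have h3 : (G x z)⁻¹ ≤ m⁻¹ := ENNReal.inv_le_inv.2 (min_le_right _ _)
    calc _ ≤ (κ : ℝ≥0∞) * (m⁻¹ + m⁻¹) := by gcongr
      _ = _ := by ring
  have hc0 : (2 * κ : ℝ≥0∞) ≠ 0 := by simp [hκ.ne']
  have hc : (2 * κ : ℝ≥0∞) ≠ ∞ := ENNReal.mul_ne_top (by simp) (by simp)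
  have h4 := ENNReal.inv_le_inv.2 h1
  rw [inv_inv, ENNReal.mul_inv (Or.inl hc0) (Or.inl hc), inv_inv] at h4
  calc m = 2 * κ * ((2 * κ : ℝ≥0∞)⁻¹ * m) := by
        rw [← mul_assoc, ENNReal.mul_inv_cancel hc0 hc, one_mul]
    _ ≤ _ := by gcongr

theorem IsQuasiMetricKernel.mem_kernelBall_comm (hG : IsQuasiMetricKernel G κ) {x y : Ω} {r : ℝ} :
    y ∈ kernelBall G x r ↔ x ∈ kernelBall G y r := by
  rw [kernelBall, kernelBall, mem_ofPred_eq, mem_ofPred_eq, hG.symm]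

theorem IsQuasiMetricKernel.mem_kernelBall_trans (hG : IsQuasiMetricKernel G κ) (hκ : 0 < κ)
    {x y z : Ω} {a b c : ℝ} (ha : 0 < a) (hb : 0 < b) (hc : κ * (a + b) ≤ c)
    (hy : y ∈ kernelBall G x a) (hz : z ∈ kernelBall G y b) : z ∈ kernelBall G x c := by
  have hκ' : (0 : ℝ) < κ := hκ
  have h0 : (0 : ℝ) < κ * (a + b) := by positivity
  refine kernelBall_subset h0 hc ((mem_kernelBall h0).2 ?_)
  rw [mem_kernelBall ha] at hy
  rw [mem_kernelBall hb] at hz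
  refine (hG.quasi_triangle x z y).trans_lt ?_
  rw [ENNReal.ofReal_mul hκ'.le, ENNReal.ofReal_coe_nnreal, ENNReal.ofReal_add ha.le hb.le]
  exact (ENNReal.mul_lt_mul_iff_right (by simp [hκ.ne']) (by simp)).2 (ENNReal.add_lt_add hy hz)

theorem IsKernel.measurableSet_kernelBall [MeasurableSpace Ω] [BorelSpace Ω] (hG : IsKernel G)
    (x : Ω) (r : ℝ) : MeasurableSet (kernelBall G x r) :=
  (hG.isOpen_kernelBall x r).measurableSet

variable [SecondCountableTopology Ω] [MeasurableSpace Ω] [BorelSpace Ω]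

theorem IsQuasiMetricKernel.truncIntegral_le (hG : IsQuasiMetricKernel G κ) (hκ : 0 < κ)
    (μ : Measure Ω) (x y : Ω) :
    truncIntegral μ (G x) y ≤ 2 * κ * potential G μ y := by
  rw [truncIntegral, potential, ← lintegral_const_mul _ (hG.measurable_apply y)]
  refine lintegral_mono fun z => ?_
  rw [min_comm]
  exact hG.min_le hκ x y z

/-- The lower bound of a positive supersolution by the linear potential. -/
theorem IsQuasiMetricKernel.potential_le_of_supersolution (hG : IsQuasiMetricKernel G κ)
    (hκ : 0 < κ) {q : ℝ} (hq0 : 0 < q) (hq1 : q < 1) (σ : Measure Ω) [SFinite σ]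
    {u : Ω → ℝ≥0∞} (hu : Measurable u) (hpos : ∀ᵐ x ∂σ, 0 < u x) (htop : ∀ᵐ x ∂σ, u x < ∞)
    (hle : ∀ᵐ x ∂σ, powPotential G q σ u x ≤ u x) (x : Ω) :
    potential G σ x ≤ (2 * κ) ^ q * weakConst q * powPotential G q σ u x ^ (1 - q) := by
  set μ := σ.withDensity fun y => u y ^ q with hμ
  have hg := hG.measurable_apply x
  set P := truncIntegral μ (G x) with hP
  have hPm : Measurable P := measurable_truncIntegral μ hg
  have hc : (2 * κ : ℝ≥0∞) ≠ ∞ := ENNReal.mul_ne_top (by simp) (by simp)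
  have hc0 : (2 * κ : ℝ≥0∞) ≠ 0 := by simp [hκ.ne']
  -- Since `P ≤ 2κ u`, inserting `1 ≤ (2κ u / P) ^ q` replaces `σ` by `u ^ q dσ`.
  have hpt : ∀ᵐ y ∂σ, G x y ≤ (2 * κ) ^ q * (u y ^ q * (G x y * (P y)⁻¹ ^ q)) := by
    filter_upwards [hpos, htop, hle] with y h1 h2 h3
    have h4 : P y ≤ 2 * κ * u y :=
      (hG.truncIntegral_le hκ μ x y).trans (mul_le_mul_right h3 _)
    have h5 : 1 ≤ 2 * κ * u y * (P y)⁻¹ := by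
      rw [← ENNReal.mul_inv_cancel (mul_ne_zero hc0 h1.ne') (ENNReal.mul_ne_top hc h2.ne)]
      exact mul_le_mul_right (ENNReal.inv_le_inv.2 h4) _
    have h6 := ENNReal.rpow_le_rpow h5 hq0.le
    rw [ENNReal.one_rpow, ENNReal.mul_rpow_of_nonneg _ _ hq0.le,
      ENNReal.mul_rpow_of_nonneg _ _ hq0.le] at h6
    calc G x y = 1 * G x y := (one_mul _).symm
      _ ≤ (2 * κ) ^ q * u y ^ q * (P y)⁻¹ ^ q * G x y := by gcongr
      _ = _ := by ring
  have hweak := lintegral_rpow_le_of_weak hq0 hq1 (μ.withDensity (G x)) hPm.inv 1 (by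
    intro t ht0 ht
    have hs : MeasurableSet {y | t < (P y)⁻¹} := measurableSet_lt measurable_const hPm.inv
    change μ.withDensity (G x) {y | t < (P y)⁻¹} ≤ 1 / t
    rw [withDensity_apply _ hs, one_div]
    refine (lintegral_mono_set fun y hy => ?_).trans (setLIntegral_truncIntegral_le μ hg t⁻¹)
    exact (ENNReal.lt_inv_iff_lt_inv.1 hy).le)
  rw [ENNReal.one_rpow, mul_one, withDensity_apply _ MeasurableSet.univ,
    Measure.restrict_univ, lintegral_withDensity_eq_lintegral_mul _ hg (hPm.inv.pow_const q),
    lintegral_withDensity_eq_lintegral_mul _ (hu.pow_const q) (hg.mul (hPm.inv.pow_const q))]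
    at hweak
  calc potential G σ x ≤ ∫⁻ y, (2 * κ) ^ q * (u y ^ q * (G x y * (P y)⁻¹ ^ q)) ∂σ :=
        lintegral_mono_ae hpt
    _ = (2 * κ) ^ q * ∫⁻ y, u y ^ q * (G x y * (P y)⁻¹ ^ q) ∂σ :=
        lintegral_const_mul' _ _ (ENNReal.rpow_ne_top_of_nonneg hq0.le hc)
    _ ≤ (2 * κ) ^ q * (weakConst q * powPotential G q σ u x ^ (1 - q)) :=
        mul_le_mul_right hweak _
    _ = _ := by ring

/-- At least half of the mass `I` of `G(x, ·) dσ` sits where the truncated integral exceeds `I / 2`,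
and there `𝐆σ` exceeds `I / (4κ)`. This supplies the initial subsolution of the iteration. -/
theorem IsQuasiMetricKernel.potential_rpow_le (hG : IsQuasiMetricKernel G κ) (hκ : 0 < κ)
    {p : ℝ} (hp : 0 < p) (σ : Measure Ω) [SFinite σ] (x : Ω) :
    potential G σ x ^ (1 + p) ≤
      2 ^ (1 + p) * (2 * κ) ^ p * ∫⁻ y, G x y * potential G σ y ^ p ∂σ := by
  have hg := hG.measurable_apply x
  set P := truncIntegral σ (G x) with hP
  have hPm : Measurable P := measurable_truncIntegral σ hg
  have hc : (2 * κ : ℝ≥0∞) ≠ ∞ := ENNReal.mul_ne_top (by simp) (by simp)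
  have hc0 : (2 * κ : ℝ≥0∞) ≠ 0 := by simp [hκ.ne']
  have hc1 : (2 : ℝ≥0∞) ^ (1 + p) ≠ 0 := by simp
  set I := potential G σ x with hI
  set J := ∫⁻ y, G x y * potential G σ y ^ p ∂σ with hJ
  have key : ∀ a : ℝ≥0∞, I ≤ a + ∫⁻ y in {y | P y ≤ a}ᶜ, G x y ∂σ ∧
      a ^ p * ∫⁻ y in {y | P y ≤ a}ᶜ, G x y ∂σ ≤ (2 * κ) ^ p * J := by
    intro a
    have hs : MeasurableSet {y | P y ≤ a} := measurableSet_le hPm measurable_const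
    constructor
    · rw [hI, potential, ← lintegral_add_compl _ hs]
      gcongr
      exact setLIntegral_truncIntegral_le σ hg a
    · rw [← lintegral_const_mul _ hg, hJ, ← lintegral_const_mul' _ _
        (ENNReal.rpow_ne_top_of_nonneg hp.le hc)]
      refine le_trans (setLIntegral_mono_ae' hs.compl (.of_forall fun y hy => ?_))
        (setLIntegral_le_lintegral _ _)
      have h1 : a ≤ 2 * κ * potential G σ y :=
        (le_of_lt (not_le.1 (by exact hy))).trans (hG.truncIntegral_le hκ σ x y)
      calc a ^ p * G x y ≤ (2 * κ * potential G σ y) ^ p * G x y := by gcongr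
        _ = _ := by rw [ENNReal.mul_rpow_of_nonneg _ _ hp.le]; ring
  rcases eq_or_ne I ∞ with hItop | hItop
  -- Any finite positive threshold works here; `I / 2` would be infinite.
  · obtain ⟨h1, h2⟩ := key 1
    rw [hItop, top_le_iff, ENNReal.add_eq_top] at h1
    rw [h1.resolve_left (by simp), ENNReal.one_rpow, one_mul, top_le_iff] at h2
    rw [mul_assoc, h2, ENNReal.mul_top hc1]
    exact le_top
  · obtain ⟨h1, h2⟩ := key (I / 2)
    have h3 : I / 2 ≤ ∫⁻ y in {y | P y ≤ I / 2}ᶜ, G x y ∂σ := by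
      have hfin : I / 2 ≠ ∞ := ENNReal.div_ne_top hItop (by simp)
      rw [← ENNReal.add_le_add_iff_left hfin, ENNReal.add_halves]
      exact h1
    have hI2 : I = 2 * (I / 2) := (ENNReal.mul_div_cancel (by simp) (by simp)).symm
    calc I ^ (1 + p) = 2 ^ (1 + p) * (I / 2) ^ (1 + p) := by
          conv_lhs => rw [hI2]
          rw [ENNReal.mul_rpow_of_nonneg _ _ (by positivity)]
      _ = 2 ^ (1 + p) * ((I / 2) ^ p * (I / 2)) := by
          rw [ENNReal.rpow_add_of_nonneg (x := I / 2) _ _ (by positivity) hp.le,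
            ENNReal.rpow_one, mul_comm (I / 2)]
      _ ≤ 2 ^ (1 + p) * ((2 * κ) ^ p * J) := by
          exact mul_le_mul_right ((mul_le_mul_right h3 _).trans h2) _
      _ = _ := by ring

end Kernel

end SublinearPotential

namespace SublinearPotential

/-! ### The weak type inequality and the bound of `ϰ` by the mass of a supersolution. -/

section Capacity

variable {Ω : Type*} {G : Ω → Ω → ℝ≥0∞} {κ : ℝ≥0} [TopologicalSpace Ω]
  [SecondCountableTopology Ω] [MeasurableSpace Ω] [BorelSpace Ω]

/-- Selection of a radius where the mass of `ν` dominates that of `μ` on an enlarged ball. -/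
theorem IsKernel.exists_radius (hG : IsKernel G) (ν μ : Measure Ω) [SFinite ν] [SFinite μ]
    {A : ℝ} (hA : 0 < A) {t : ℝ≥0∞} (ht : t ≠ ∞) {x : Ω}
    (hx : t * potential G μ x < potential G ν x) :
    ∃ r : ℝ, 0 < r ∧
      t * μ (kernelBall G x (A * r)) < ENNReal.ofReal A * ν (kernelBall G x r) := by
  by_contra! hcon
  refine absurd hx (not_lt.2 ?_)
  have hA0 : ENNReal.ofReal A ≠ 0 := (ENNReal.ofReal_pos.2 hA).ne'
  have hg := hG.measurable_apply x
  rw [← ENNReal.mul_le_mul_iff_right hA0 ENNReal.ofReal_ne_top]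
  calc ENNReal.ofReal A * potential G ν x
      = ∫⁻ r in Ioi (0 : ℝ),
          ENNReal.ofReal A * (ν (kernelBall G x r) / ENNReal.ofReal (r ^ 2)) := by
        rw [← lintegral_kernelBall ν hg, lintegral_const_mul' _ _ ENNReal.ofReal_ne_top]
    _ ≤ ∫⁻ r in Ioi (0 : ℝ), t * (μ (kernelBall G x (A * r)) / ENNReal.ofReal (r ^ 2)) := by
        refine setLIntegral_mono_ae' measurableSet_Ioi (.of_forall fun r hr => ?_)
        rw [← mul_div_assoc, ← mul_div_assoc]
        exact ENNReal.div_le_div_right (hcon r hr) _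
    _ = ENNReal.ofReal A * (t * potential G μ x) := by
        rw [lintegral_const_mul' _ _ ht, lintegral_kernelBall_mul μ hg hA]
        ring

/-- The weak type `(1, 1)` inequality for `ν ↦ 𝐆ν / 𝐆μ` with respect to `μ`. -/
theorem IsQuasiMetricKernel.weak_type (hG : IsQuasiMetricKernel G κ) (hκ : 0 < κ)
    (ν μ : Measure Ω) [SFinite ν] [SFinite μ] {t : ℝ≥0∞} (ht0 : t ≠ 0) (ht : t ≠ ∞) :
    μ {x | t * potential G μ x < potential G ν x} ≤ 3 * κ * ν univ / t := by
  have hκ' : (0 : ℝ) < κ := hκ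
  -- If balls of radii `s x ≤ 2 * s b` meet, then `x` lies within `κ (s b + s x) ≤ 3κ s b` of `b`.
  set A : ℝ := 3 * κ with hAdef
  have hA : 0 < A := by positivity
  have hAe : ENNReal.ofReal A = 3 * κ := by
    rw [hAdef, ENNReal.ofReal_mul (by norm_num), ENNReal.ofReal_coe_nnreal]
    norm_num
  set S := {x | t * potential G μ x < potential G ν x} with hS
  rcases S.eq_empty_or_nonempty with hemp | ⟨x₀, hx₀⟩
  · simp [hemp]
  have hsel : ∀ x : Ω, ∃ r : ℝ, x ∈ S → 0 < r ∧
      t * μ (kernelBall G x (A * r)) < 3 * κ * ν (kernelBall G x r) := by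
    intro x
    by_cases hx : x ∈ S
    · obtain ⟨r, hr⟩ := hG.exists_radius ν μ hA ht hx
      rw [hAe] at hr
      exact ⟨r, fun _ => hr⟩
    · exact ⟨0, fun h => absurd h hx⟩
  choose s hs using hsel
  rw [ENNReal.le_div_iff_mul_le (Or.inl ht0) (Or.inl ht), mul_comm]
  -- The covering lemma needs bounded radii, hence the localisation. If some selected radius is at
  -- least `R`, that one enlarged ball already covers the localised set.
  have hbdd : ∀ R : ℝ, 0 < R → t * μ (S ∩ kernelBall G x₀ R) ≤ 3 * κ * ν univ := by
    intro R hR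
    by_cases hbig : ∃ x ∈ S ∩ kernelBall G x₀ R, R ≤ s x
    · obtain ⟨x, ⟨hxS, hxR⟩, hRs⟩ := hbig
      have hsub : S ∩ kernelBall G x₀ R ⊆ kernelBall G x (A * s x) := by
        rintro y ⟨-, hy⟩
        refine hG.mem_kernelBall_trans hκ hR hR ?_ (hG.mem_kernelBall_comm.1 hxR) hy
        rw [hAdef]
        nlinarith
      calc _ ≤ t * μ (kernelBall G x (A * s x)) := by gcongr
        _ ≤ 3 * κ * ν (kernelBall G x (s x)) := (hs x hxS).2.le
        _ ≤ _ := by gcongr; exact subset_univ _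
    · push Not at hbig
      -- A ball need not contain its centre, as `G x x` may be finite; nonemptiness comes from the
      -- strict inequality defining `s x`.
      have hne : ∀ x ∈ S ∩ kernelBall G x₀ R, (kernelBall G x (s x)).Nonempty := by
        intro x hx
        rw [nonempty_iff_ne_empty]
        intro h
        have := (hs x hx.1).2
        simp [h] at this
      obtain ⟨v, hvS, hvd, hv⟩ := Vitali.exists_disjoint_subfamily_covering_enlargement
        (fun x => kernelBall G x (s x)) (S ∩ kernelBall G x₀ R) s 2 (by norm_num)
        (fun x hx => (hs x hx.1).1.le) R (fun x hx => (hbig x hx).le) hne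
      have hvc : v.Countable := hvd.countable_of_isOpen
        (fun x _ => hG.isOpen_kernelBall x (s x)) (fun x hx => hne x (hvS hx))
      have hcov : S ∩ kernelBall G x₀ R ⊆ ⋃ b ∈ v, kernelBall G b (A * s b) := by
        intro x hx
        obtain ⟨b, hb, ⟨z, hzx, hzb⟩, hsb⟩ := hv x hx
        refine mem_iUnion₂.2 ⟨b, hb, ?_⟩
        refine hG.mem_kernelBall_trans hκ (hs b (hvS hb).1).1 (hs x hx.1).1 ?_ hzb
          (hG.mem_kernelBall_comm.1 hzx)
        rw [hAdef]
        nlinarith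
      calc t * μ (S ∩ kernelBall G x₀ R)
          ≤ t * ∑' b : v, μ (kernelBall G b.1 (A * s b.1)) := by
            gcongr
            exact (measure_mono hcov).trans (measure_biUnion_le _ hvc _)
        _ = ∑' b : v, t * μ (kernelBall G b.1 (A * s b.1)) := ENNReal.tsum_mul_left.symm
        _ ≤ ∑' b : v, 3 * κ * ν (kernelBall G b.1 (s b.1)) :=
            ENNReal.tsum_le_tsum fun b => (hs b.1 (hvS b.2).1).2.le
        _ = 3 * κ * ν (⋃ b ∈ v, kernelBall G b (s b)) := by
            rw [ENNReal.tsum_mul_left, measure_biUnion hvc hvd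
              fun b _ => hG.measurableSet_kernelBall b (s b)]
        _ ≤ _ := by gcongr; exact subset_univ _
  have hun : S = ⋃ n : ℕ, S ∩ kernelBall G x₀ (n + 1 : ℝ) := by
    rw [← inter_iUnion, eq_comm, inter_eq_left]
    intro y _
    obtain ⟨n, hn⟩ := ENNReal.exists_nat_gt (ENNReal.inv_ne_top.2 (hG.pos x₀ y).ne')
    refine mem_iUnion.2 ⟨n, (mem_kernelBall (by positivity)).2 (hn.trans_le ?_)⟩
    rw [← ENNReal.ofReal_natCast]
    exact ENNReal.ofReal_le_ofReal (by linarith)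
  have hmono : Monotone fun n : ℕ => S ∩ kernelBall G x₀ (n + 1 : ℝ) := by
    intro n m hnm
    refine inter_subset_inter_right _ (kernelBall_subset (by positivity) ?_)
    exact_mod_cast Nat.succ_le_succ hnm
  rw [hun, hmono.measure_iUnion, ENNReal.mul_iSup]
  exact iSup_le fun n => hbdd _ (by positivity)

omit [SecondCountableTopology Ω] [BorelSpace Ω] in
theorem le_leastConst_mul (q : ℝ) (hq0 : 0 < q) (σ : Measure Ω) (E : Set Ω) (ν : Measure Ω)
    [IsFiniteMeasure ν] :
    (∫⁻ x in E, potential G ν x ^ q ∂σ) ^ (1 / q) ≤ leastConst G q σ E * ν univ := by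
  rcases eq_or_ne (ν univ) 0 with h0 | h0
  · rw [Measure.measure_univ_eq_zero.1 h0]
    simp [potential, hq0]
  · rw [← ENNReal.div_le_iff h0 (measure_ne_top ν univ)]
    refine le_sInf fun C hC => ?_
    rw [ENNReal.div_le_iff h0 (measure_ne_top ν univ)]
    exact hC ν inferInstance

/-- The constant in `IsQuasiMetricKernel.leastConst_rpow_le`. -/
noncomputable def capacityConst (q : ℝ) (κ : ℝ≥0) : ℝ≥0∞ :=
  ((weakConst q * (3 * κ) ^ q) ^ (1 / q)) ^ (q / (1 - q))

theorem capacityConst_ne_top {q : ℝ} (hq0 : 0 < q) (hq1 : q < 1) (κ : ℝ≥0) :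
    capacityConst q κ ≠ ∞ := by
  have h1 : 0 < 1 - q := by linarith
  refine ENNReal.rpow_ne_top_of_nonneg (by positivity)
    (ENNReal.rpow_ne_top_of_nonneg (by positivity) ?_)
  exact ENNReal.mul_ne_top (weakConst_ne_top hq1)
    (ENNReal.rpow_ne_top_of_nonneg hq0.le (ENNReal.mul_ne_top (by simp) (by simp)))

/-- The mass of `u ^ q dσ` on `E` for a supersolution `u` bounds the constant `ϰ(E)`. -/
theorem IsQuasiMetricKernel.leastConst_rpow_le (hG : IsQuasiMetricKernel G κ)
    (hκ : 0 < κ) {q : ℝ} (hq0 : 0 < q) (hq1 : q < 1) (σ : Measure Ω) [SFinite σ]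
    {u : Ω → ℝ≥0∞} (hu : Measurable u) (hpos : ∀ᵐ x ∂σ, 0 < u x) (htop : ∀ᵐ x ∂σ, u x < ∞)
    (hle : ∀ᵐ x ∂σ, powPotential G q σ u x ≤ u x) {E : Set Ω} (hE : MeasurableSet E) :
    leastConst G q σ E ^ (q / (1 - q)) ≤
      capacityConst q κ * (σ.withDensity fun y => u y ^ q) E := by
  set μ := σ.withDensity fun y => u y ^ q with hμ
  have h1q : 0 < 1 - q := by linarith
  have hbase : weakConst q * (3 * κ : ℝ≥0∞) ^ q ≠ 0 := by
    refine mul_ne_zero (weakConst_ne_zero q) ?_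
    have : (3 * κ : ℝ≥0∞) ≠ 0 := by simp [hκ.ne']
    simp [this, hκ.ne', ENNReal.mul_eq_top]
  have hmem : leastConst G q σ E ≤
      (weakConst q * (3 * κ) ^ q) ^ (1 / q) * μ E ^ ((1 - q) / q) := by
    refine sInf_le fun ν _ => ?_
    -- Positivity of `u` makes `σ` absolutely continuous with respect to `μ`, so `σ E = 0` here.
    by_cases hμE : μ E = 0
    · have hac : σ ≪ μ := withDensity_absolutelyContinuous' (hu.pow_const q).aemeasurable <| by
        filter_upwards [hpos, htop] with x h1 h2
        simp [h1.ne', h2.ne]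
      rw [Measure.restrict_eq_zero.2 (hac hμE)]
      simp [hq0]
    by_cases hνtop : ν univ = ∞
    · rw [hνtop, ENNReal.mul_top]
      · exact le_top
      · exact mul_ne_zero (mt (ENNReal.rpow_eq_zero_iff_of_pos (by positivity)).1 hbase)
          (mt (ENNReal.rpow_eq_zero_iff_of_pos (by positivity)).1 hμE)
    have : IsFiniteMeasure ν := ⟨lt_top_iff_ne_top.2 hνtop⟩
    have hpν := hG.measurable_potential ν
    have hquot : Measurable fun x => potential G ν x * (u x)⁻¹ := hpν.mul hu.inv
    -- Restricting to `E` makes the total mass `μ E`; the weak bound survives because `𝐆(μ|E) ≤ 𝐆μ ≤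
    -- u`.
    have hweak := lintegral_rpow_le_of_weak hq0 hq1 (μ.restrict E)
      hquot (3 * κ * ν univ) (by
      intro t ht0 ht
      refine le_trans (measure_mono_ae ?_) (hG.weak_type hκ ν (μ.restrict E) ht0 ht)
      have hac : μ.restrict E ≪ σ :=
        Measure.restrict_le_self.absolutelyContinuous.trans (withDensity_absolutelyContinuous _ _)
      filter_upwards [hac.ae_le hpos, hac.ae_le htop, hac.ae_le hle] with x h1 h2 h3 h4
      have h5 : t * u x < potential G ν x := by
        have h4' : t < potential G ν x / u x := h4
        rwa [ENNReal.lt_div_iff_mul_lt (Or.inl h1.ne') (Or.inl h2.ne)] at h4'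
      refine lt_of_le_of_lt ?_ h5
      exact mul_le_mul_right ((potential_mono Measure.restrict_le_self x).trans h3) t)
    rw [Measure.restrict_apply_univ, hμ, restrict_withDensity hE,
      lintegral_withDensity_eq_lintegral_mul _ (hu.pow_const q)
        (hquot.pow_const q)] at hweak
    have hint : ∫⁻ x in E, potential G ν x ^ q ∂σ ≤
        weakConst q * (3 * κ) ^ q * (μ E ^ (1 - q) * ν univ ^ q) := by
      refine le_trans (lintegral_mono_ae ?_) (hweak.trans_eq ?_)
      · filter_upwards [ae_restrict_of_ae hpos, ae_restrict_of_ae htop] with x h1 h2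
        rw [Pi.mul_apply, ← ENNReal.mul_rpow_of_nonneg _ _ hq0.le]
        refine le_of_eq ?_
        rw [mul_left_comm, ENNReal.mul_inv_cancel h1.ne' h2.ne, mul_one]
      · rw [ENNReal.mul_rpow_of_nonneg _ _ hq0.le]
        ring
    refine (ENNReal.rpow_le_rpow hint (by positivity : 0 ≤ 1 / q)).trans_eq ?_
    have hqi : 0 ≤ 1 / q := by positivity
    rw [ENNReal.mul_rpow_of_nonneg _ _ hqi, ENNReal.mul_rpow_of_nonneg (_ ^ _) _ hqi,
      ← ENNReal.rpow_mul (μ E), ← ENNReal.rpow_mul (ν univ), mul_one_div, mul_one_div,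
      div_self hq0.ne', ENNReal.rpow_one, mul_assoc]
  calc leastConst G q σ E ^ (q / (1 - q))
      ≤ ((weakConst q * (3 * κ) ^ q) ^ (1 / q) * μ E ^ ((1 - q) / q)) ^ (q / (1 - q)) :=
        ENNReal.rpow_le_rpow hmem (by positivity)
    _ = _ := by
        rw [ENNReal.mul_rpow_of_nonneg _ _ (by positivity), ← ENNReal.rpow_mul (μ E),
          capacityConst, show (1 - q) / q * (q / (1 - q)) = 1 by field_simp, ENNReal.rpow_one]

theorem IsQuasiMetricKernel.nonlinearPotential_le (hG : IsQuasiMetricKernel G κ)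
    (hκ : 0 < κ) {q : ℝ} (hq0 : 0 < q) (hq1 : q < 1) (σ : Measure Ω) [SFinite σ]
    {u : Ω → ℝ≥0∞} (hu : Measurable u) (hpos : ∀ᵐ x ∂σ, 0 < u x) (htop : ∀ᵐ x ∂σ, u x < ∞)
    (hle : ∀ᵐ x ∂σ, powPotential G q σ u x ≤ u x) (x : Ω) :
    nonlinearPotential G q σ x ≤ capacityConst q κ * powPotential G q σ u x := by
  rw [powPotential, ← lintegral_kernelBall _ (hG.measurable_apply x),
    ← lintegral_const_mul' _ _ (capacityConst_ne_top hq0 hq1 κ), nonlinearPotential]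
  refine lintegral_mono fun r => ?_
  rw [← mul_div_assoc]
  exact ENNReal.div_le_div_right (hG.leastConst_rpow_le hκ hq0 hq1 σ hu hpos htop hle
    (hG.measurableSet_kernelBall x r)) _

end Capacity

end SublinearPotential

namespace SublinearPotential

/-! ### The a priori upper bound for subsolutions. -/

section Upper

variable {Ω : Type*} {G : Ω → Ω → ℝ≥0∞} {κ : ℝ≥0} [TopologicalSpace Ω]
  [SecondCountableTopology Ω] [MeasurableSpace Ω] [BorelSpace Ω]

theorem IsKernel.measure_kernelBall_lt_top (hG : IsKernel G) (μ : Measure Ω) {x : Ω}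
    (hx : potential G μ x ≠ ∞) {r : ℝ} (hr : 0 < r) : μ (kernelBall G x r) < ∞ := by
  have h0 : ENNReal.ofReal (1 / r) ≠ 0 := (ENNReal.ofReal_pos.2 (by positivity)).ne'
  have h1 : μ {y | ENNReal.ofReal (1 / r) ≤ G x y} ≤ potential G μ x / ENNReal.ofReal (1 / r) :=
    meas_ge_le_lintegral_div (hG.measurable_apply x).aemeasurable h0 ENNReal.ofReal_ne_top
  refine ((measure_mono fun y hy => ?_).trans h1).trans_lt (ENNReal.div_lt_top hx h0)
  exact le_of_lt (show ENNReal.ofReal (1 / r) < G x y from hy)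

/-- On a ball, the potential of the part of `μ` far from the ball is controlled by the value of
`𝐆μ` at the center. -/
theorem IsQuasiMetricKernel.potential_le_near_add_far (hG : IsQuasiMetricKernel G κ) (hκ : 0 < κ)
    (μ : Measure Ω) {x y : Ω} {r : ℝ} (hr : 0 < r) (hy : y ∈ kernelBall G x r) :
    potential G μ y ≤
      potential G (μ.restrict (kernelBall G x (2 * κ * r))) y + 2 * κ * potential G μ x := by
  have hκ' : (0 : ℝ) < κ := hκ
  have hB := hG.measurableSet_kernelBall x (2 * κ * r)
  rw [potential, ← lintegral_add_compl _ hB, potential, potential,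
    ← lintegral_const_mul _ (hG.measurable_apply x)]
  refine add_le_add le_rfl (le_trans (setLIntegral_mono_ae' hB.compl (.of_forall fun z hz => ?_))
    (setLIntegral_le_lintegral _ _))
  have h1 := hG.min_le hκ y x z
  rw [min_le_iff] at h1
  -- The other alternative would give `G y x ≤ 2κ G x z ≤ 1 / r`, contradicting `y ∈ B(x, r)`; this
  -- fixes the enlargement factor `2κ`.
  refine h1.resolve_left fun h2 => ?_
  have h3 : G x z ≤ ENNReal.ofReal (1 / (2 * κ * r)) := not_lt.1 hz
  have h4 : ENNReal.ofReal (1 / r) < G x y := hy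
  refine absurd (h4.trans_le ?_) (lt_irrefl (ENNReal.ofReal (1 / r)))
  rw [hG.symm x y]
  refine h2.trans ((mul_le_mul_right h3 _).trans_eq ?_)
  have h5 : (2 * κ : ℝ≥0∞) = ENNReal.ofReal (2 * κ) := by
    rw [ENNReal.ofReal_mul (by norm_num), ENNReal.ofReal_coe_nnreal]
    norm_num
  rw [h5, ← ENNReal.ofReal_mul (by positivity)]
  congr 1
  field_simp

/-- The mass of a ball for the measure `u ^ q dσ`, where `u` is a subsolution. -/
theorem IsQuasiMetricKernel.withDensity_kernelBall_le (hG : IsQuasiMetricKernel G κ)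
    (hκ : 0 < κ) {q : ℝ} (hq0 : 0 < q) (hq1 : q < 1) (σ : Measure Ω) [SFinite σ]
    {f u : Ω → ℝ≥0∞}
    (hle : ∀ᵐ x ∂σ, u x ≤ powPotential G q σ u x + f x) {x : Ω}
    (hx : powPotential G q σ u x ≠ ∞) {r : ℝ} (hr : 0 < r) :
    (σ.withDensity fun y => u y ^ q) (kernelBall G x r) ≤
      leastConst G q σ (kernelBall G x r) ^ q *
        (σ.withDensity fun y => u y ^ q) (kernelBall G x (2 * κ * r)) ^ q +
      ((2 * κ * powPotential G q σ u x) ^ q * σ (kernelBall G x r) +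
        (σ.withDensity fun y => f y ^ q) (kernelBall G x r)) := by
  have hκ' : (0 : ℝ) < κ := hκ
  set μ := σ.withDensity fun y => u y ^ q with hμ
  set B := kernelBall G x r with hBdef
  set B' := kernelBall G x (2 * κ * r) with hB'def
  set I := powPotential G q σ u x with hI
  have hB : MeasurableSet B := hG.measurableSet_kernelBall x r
  have hB'fin : μ B' < ∞ := hG.measure_kernelBall_lt_top μ hx (by positivity)
  have hfin : IsFiniteMeasure (μ.restrict B') := ⟨by rwa [Measure.restrict_apply_univ]⟩
  have hnear : ∫⁻ y in B, potential G (μ.restrict B') y ^ q ∂σ ≤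
      leastConst G q σ B ^ q * μ B' ^ q := by
    have h := ENNReal.rpow_le_rpow (le_leastConst_mul (G := G) q hq0 σ B (μ.restrict B')) hq0.le
    rwa [← ENNReal.rpow_mul, one_div, inv_mul_cancel₀ hq0.ne', ENNReal.rpow_one,
      ENNReal.mul_rpow_of_nonneg _ _ hq0.le, Measure.restrict_apply_univ] at h
  have hpm : Measurable fun y => potential G (μ.restrict B') y ^ q :=
    (hG.measurable_potential _).pow_const q
  calc μ B = ∫⁻ y in B, u y ^ q ∂σ := withDensity_apply _ hB
    _ ≤ ∫⁻ y in B, (potential G (μ.restrict B') y ^ q + ((2 * κ * I) ^ q + f y ^ q)) ∂σ := by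
        refine setLIntegral_mono_ae' hB ?_
        filter_upwards [hle] with y hy hyB
        have h1 : u y ≤ potential G (μ.restrict B') y + (2 * κ * I + f y) := by
          rw [← add_assoc]
          exact hy.trans
            (add_le_add (hG.potential_le_near_add_far hκ μ hr hyB) le_rfl)
        refine (ENNReal.rpow_le_rpow h1 hq0.le).trans ?_
        refine (ENNReal.rpow_add_le_add_rpow _ _ hq0.le hq1.le).trans ?_
        gcongr
        exact ENNReal.rpow_add_le_add_rpow _ _ hq0.le hq1.le
    _ = (∫⁻ y in B, potential G (μ.restrict B') y ^ q ∂σ) +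
          ((2 * κ * I) ^ q * σ B + ∫⁻ y in B, f y ^ q ∂σ) := by
        rw [lintegral_add_left hpm, lintegral_add_left measurable_const, lintegral_const,
          Measure.restrict_apply_univ]
    _ ≤ _ := by
        rw [withDensity_apply _ hB]
        gcongr

/-- The parameter used in Young's inequality in the proof of the upper bound. -/
noncomputable def youngParam (q : ℝ) (κ : ℝ≥0) : ℝ≥0∞ := ((8 * κ : ℝ≥0∞)⁻¹) ^ (1 / (1 - q))

theorem youngParam_ne_zero {q : ℝ} (hq1 : q < 1) (κ : ℝ≥0) : youngParam q κ ≠ 0 := by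
  have h1q : 0 < 1 - q := by linarith
  rw [youngParam, Ne, ENNReal.rpow_eq_zero_iff_of_pos (by positivity), ENNReal.inv_eq_zero]
  exact ENNReal.mul_ne_top (by simp) (by simp)

theorem youngParam_ne_top {q : ℝ} (hq1 : q < 1) (hκ : 0 < κ) : youngParam q κ ≠ ∞ := by
  have h1q : 0 < 1 - q := by linarith
  refine ENNReal.rpow_ne_top_of_nonneg (by positivity) (ENNReal.inv_ne_top.2 ?_)
  simp [hκ.ne']

/-- Young's inequality is used twice, so each use may cost a quarter of the potential, leaving half
after absorption. -/
theorem youngParam_rpow_mul {q : ℝ} (hq1 : q < 1) (hκ : 0 < κ) :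
    youngParam q κ ^ (1 - q) * (2 * κ) = 4⁻¹ := by
  have h1q : 1 - q ≠ 0 := by linarith
  have h8 : (8 * κ : ℝ≥0∞) = 4 * (2 * κ) := by rw [← mul_assoc]; norm_num
  have h2 : (2 * κ : ℝ≥0∞) ≠ 0 := by simp [hκ.ne']
  have h2' : (2 * κ : ℝ≥0∞) ≠ ∞ := ENNReal.mul_ne_top (by simp) (by simp)
  rw [youngParam, ← ENNReal.rpow_mul, one_div, inv_mul_cancel₀ h1q, ENNReal.rpow_one, h8,
    ENNReal.mul_inv (Or.inl (by simp)) (Or.inl (by simp)), mul_assoc,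
    ENNReal.inv_mul_cancel h2 h2', mul_one]

/-- The constant in the upper bound of subsolutions. -/
noncomputable def upperConst (q : ℝ) (κ : ℝ≥0) : ℝ≥0∞ := 2 * ((youngParam q κ ^ q)⁻¹ + 1)

theorem upperConst_ne_top {q : ℝ} (hq0 : 0 < q) (hq1 : q < 1) (κ : ℝ≥0) :
    upperConst q κ ≠ ∞ := by
  refine ENNReal.mul_ne_top (by simp) (ENNReal.add_ne_top.2 ⟨?_, by simp⟩)
  rw [ENNReal.inv_ne_top, Ne, ENNReal.rpow_eq_zero_iff_of_pos hq0]
  exact youngParam_ne_zero hq1 κ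

theorem IsQuasiMetricKernel.powPotential_le_boundFun (hG : IsQuasiMetricKernel G κ)
    (hκ : 0 < κ) {q : ℝ} (hq0 : 0 < q) (hq1 : q < 1) (σ : Measure Ω) [SFinite σ]
    {f u : Ω → ℝ≥0∞}
    (hle : ∀ᵐ x ∂σ, u x ≤ powPotential G q σ u x + f x) {x : Ω}
    (hx : powPotential G q σ u x ≠ ∞) :
    powPotential G q σ u x ≤ upperConst q κ * boundFun G q σ f x := by
  have hκ' : (0 : ℝ) < κ := hκ
  have h1q : 0 < 1 - q := by linarith
  set μ := σ.withDensity fun y => u y ^ q with hμ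
  set F := σ.withDensity fun y => f y ^ q with hF
  set I := powPotential G q σ u x with hI
  set K := nonlinearPotential G q σ x with hK
  set δ := youngParam q κ with hδ
  set D := (δ ^ q)⁻¹ with hD
  have hδ0 : δ ≠ 0 := youngParam_ne_zero hq1 κ
  have hδ1 : δ ≠ ∞ := youngParam_ne_top hq1 hκ
  have hδ2 : δ ^ (1 - q) * (2 * κ) = 4⁻¹ := youngParam_rpow_mul hq1 hκ
  have hδtop : δ ^ (1 - q) ≠ ∞ := ENNReal.rpow_ne_top_of_nonneg h1q.le hδ1
  have hDtop : D ≠ ∞ := by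
    rw [hD, ENNReal.inv_ne_top, Ne, ENNReal.rpow_eq_zero_iff_of_pos hq0]
    exact hδ0
  have hg := hG.measurable_apply x
  have hctop : (2 * κ * I : ℝ≥0∞) ^ q ≠ ∞ :=
    ENNReal.rpow_ne_top_of_nonneg hq0.le
      (ENNReal.mul_ne_top (ENNReal.mul_ne_top (by simp) (by simp)) hx)
  have hA : (2 * κ : ℝ≥0∞) = ENNReal.ofReal (2 * κ) := by
    rw [ENNReal.ofReal_mul (by norm_num), ENNReal.ofReal_coe_nnreal]
    norm_num
  have hmσ := measurable_measure_kernelBall σ hg 1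
  have hmμ := measurable_measure_kernelBall μ hg (2 * κ)
  have hmF := measurable_measure_kernelBall F hg 1
  simp only [one_mul] at hmσ hmF
  have hpt : ∀ r : ℝ, 0 < r → μ (kernelBall G x r) / ENNReal.ofReal (r ^ 2) ≤
      δ ^ (1 - q) * (μ (kernelBall G x (2 * κ * r)) / ENNReal.ofReal (r ^ 2)) +
      ((2 * κ * I) ^ q * (σ (kernelBall G x r) / ENNReal.ofReal (r ^ 2)) +
      (F (kernelBall G x r) / ENNReal.ofReal (r ^ 2) +
      D * (leastConst G q σ (kernelBall G x r) ^ (q / (1 - q)) / ENNReal.ofReal (r ^ 2)))) := by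
    intro r hr
    have h1 := hG.withDensity_kernelBall_le hκ hq0 hq1 σ hle hx hr
    have h2 := young_rpow hq0 hq1 hδ0 hδ1 (leastConst G q σ (kernelBall G x r) ^ (q / (1 - q)))
      (μ (kernelBall G x (2 * κ * r)))
    rw [← ENNReal.rpow_mul, div_mul_cancel₀ q h1q.ne'] at h2
    refine (ENNReal.div_le_div_right (h1.trans (add_le_add h2 le_rfl)) _).trans_eq ?_
    simp only [div_eq_mul_inv]
    ring
  have hint : I ≤ δ ^ (1 - q) * (2 * κ * I) + ((2 * κ * I) ^ q * potential G σ x +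
      (powPotential G q σ f x + D * K)) := by
    calc I = ∫⁻ r in Ioi (0 : ℝ), μ (kernelBall G x r) / ENNReal.ofReal (r ^ 2) :=
          (lintegral_kernelBall μ hg).symm
      _ ≤ _ := setLIntegral_mono_ae' measurableSet_Ioi (.of_forall fun r hr => hpt r hr)
      _ = _ := by
        rw [lintegral_add_left (hmμ.const_mul _), lintegral_add_left (hmσ.const_mul _),
          lintegral_add_left hmF, lintegral_const_mul' _ _ hδtop, lintegral_const_mul' _ _ hctop,
          lintegral_const_mul' _ _ hDtop, lintegral_kernelBall σ hg, lintegral_kernelBall F hg,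
          lintegral_kernelBall_mul μ hg (by positivity), ← hA]
        rfl
  -- The far part is split by Young with the same `δ`, which produces the power `1 / (1 - q)` of
  -- `𝐆σ`.
  have hyoung : (2 * κ * I) ^ q * potential G σ x ≤
      δ ^ (1 - q) * (2 * κ * I) + D * potential G σ x ^ (1 / (1 - q)) := by
    have h2 := young_rpow hq0 hq1 hδ0 hδ1 (potential G σ x ^ (1 / (1 - q))) (2 * κ * I)
    rw [one_div, ← ENNReal.rpow_mul, inv_mul_cancel₀ h1q.ne', ENNReal.rpow_one, mul_comm] at h2
    rwa [one_div]
  set L := potential G σ x ^ (1 / (1 - q)) with hL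
  set N := powPotential G q σ f x with hN
  have h4 : δ ^ (1 - q) * (2 * κ * I) = I / 4 := by
    rw [← mul_assoc, hδ2, div_eq_mul_inv, mul_comm]
  rw [h4] at hint hyoung
  have hquarter : I / 4 + I / 4 = I / 2 := by
    rw [ENNReal.div_add_div_same, ← two_mul, show (4 : ℝ≥0∞) = 2 * 2 by norm_num,
      ENNReal.mul_div_mul_left _ _ (by simp) (by simp)]
  -- Absorption: cancelling `I / 2` requires `I` to be finite.
  have hhalf : I / 2 ≤ D * (L + K) + N := by
    have hfin : I / 2 ≠ ∞ := ENNReal.div_ne_top hx (by simp)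
    rw [← ENNReal.add_le_add_iff_left hfin, ENNReal.add_halves]
    calc I ≤ I / 4 + ((I / 4 + D * L) + (N + D * K)) := by
          refine hint.trans ?_
          gcongr
      _ = (I / 4 + I / 4) + (D * (L + K) + N) := by ring
      _ = _ := by rw [hquarter]
  calc I = 2 * (I / 2) := (ENNReal.mul_div_cancel (by simp) (by simp)).symm
    _ ≤ 2 * (D * (L + K) + N) := by gcongr
    _ ≤ 2 * ((D + 1) * (L + K) + (D + 1) * N) := by
        gcongr
        · exact le_self_add
        · exact le_mul_of_one_le_left zero_le le_add_self
    _ = upperConst q κ * boundFun G q σ f x := by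
        rw [upperConst, boundFun]
        ring

end Upper

end SublinearPotential

namespace SublinearPotential

/-! ### Comparison, Picard iteration and the two-sided bounds. -/

section Solutions

open Filter Topology

variable {Ω : Type*} {G : Ω → Ω → ℝ≥0∞} {κ : ℝ≥0} [MeasurableSpace Ω]

theorem powPotential_mono_ae {q : ℝ} (hq0 : 0 < q) (σ : Measure Ω)
    {u v : Ω → ℝ≥0∞} (h : ∀ᵐ x ∂σ, u x ≤ v x) (x : Ω) :
    powPotential G q σ u x ≤ powPotential G q σ v x := by
  refine potential_mono (withDensity_mono ?_) x
  filter_upwards [h] with y hy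
  exact ENNReal.rpow_le_rpow hy hq0.le

theorem powPotential_const_mul {q : ℝ} (hq0 : 0 < q) (σ : Measure Ω) {b : ℝ≥0∞} (hb : b ≠ ∞)
    (v : Ω → ℝ≥0∞) (x : Ω) :
    powPotential G q σ (fun y => b * v y) x = b ^ q * powPotential G q σ v x := by
  have h : (fun y => (b * v y) ^ q) = b ^ q • fun y => v y ^ q := by
    ext y
    simp [ENNReal.mul_rpow_of_nonneg _ _ hq0.le]
  rw [powPotential, h, withDensity_smul' _ _ (ENNReal.rpow_ne_top_of_nonneg hq0.le hb), potential,
    lintegral_smul_measure]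
  rfl

/-- A subsolution bounded by a multiple of a supersolution is bounded by the supersolution. -/
theorem le_of_le_const_mul {q : ℝ} (hq0 : 0 < q) (hq1 : q < 1) (σ : Measure Ω)
    {f u v : Ω → ℝ≥0∞} (hu : ∀ᵐ x ∂σ, u x ≤ powPotential G q σ u x + f x)
    (hv : ∀ᵐ x ∂σ, powPotential G q σ v x + f x ≤ v x) {a : ℝ} (ha : 1 ≤ a)
    (h : ∀ᵐ x ∂σ, u x ≤ ENNReal.ofReal a * v x) : ∀ᵐ x ∂σ, u x ≤ v x := by
  -- Each substitution into the equation replaces the constant by its `q`-th power; it stays at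
  -- least `1`, so `f` can be multiplied by it too.
  have hn : ∀ n : ℕ, ∀ᵐ x ∂σ, u x ≤ ENNReal.ofReal (a ^ q ^ n) * v x := by
    intro n
    induction n with
    | zero => simpa using h
    | succ n ih =>
      have h1 : 1 ≤ a ^ q ^ (n + 1) := Real.one_le_rpow ha (by positivity)
      have h2 : ENNReal.ofReal (a ^ q ^ n) ^ q = ENNReal.ofReal (a ^ q ^ (n + 1)) := by
        rw [ENNReal.ofReal_rpow_of_nonneg (by positivity) hq0.le, ← Real.rpow_mul (by linarith),
          pow_succ]
      filter_upwards [hu, hv] with x hux hvx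
      have h3 := powPotential_mono_ae (G := G) hq0 σ ih x
      rw [powPotential_const_mul hq0 σ ENNReal.ofReal_ne_top, h2] at h3
      calc u x ≤ powPotential G q σ u x + f x := hux
        _ ≤ ENNReal.ofReal (a ^ q ^ (n + 1)) * powPotential G q σ v x
            + ENNReal.ofReal (a ^ q ^ (n + 1)) * f x := by
          refine add_le_add h3 (le_mul_of_one_le_left zero_le ?_)
          rwa [ENNReal.one_le_ofReal]
        _ ≤ _ := by rw [← mul_add]; gcongr
  filter_upwards [ae_all_iff.2 hn] with x hx
  have hlim : Tendsto (fun n : ℕ => ENNReal.ofReal (a ^ q ^ n)) atTop (𝓝 1) := by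
    rw [← ENNReal.ofReal_one]
    refine ENNReal.tendsto_ofReal ?_
    have h0 : ContinuousAt (fun t : ℝ => a ^ t) 0 :=
      Real.continuousAt_const_rpow (by linarith)
    have h1 := h0.tendsto.comp (tendsto_pow_atTop_nhds_zero_of_lt_one hq0.le hq1)
    rwa [Real.rpow_zero] at h1
  have := ENNReal.Tendsto.mul_const (b := v x) hlim (Or.inl one_ne_zero)
  rw [one_mul] at this
  exact ge_of_tendsto' this hx

/-- Truncated Picard iterates for the equation `u = 𝐆(u ^ q dσ) + f`. -/
noncomputable def picardIterate (G : Ω → Ω → ℝ≥0∞) (q : ℝ) (σ : Measure Ω) (f : Ω → ℝ≥0∞)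
    (E : ℕ → Set Ω) (w : Ω → ℝ≥0∞) : ℕ → Ω → ℝ≥0∞
  | 0 => w
  | n + 1 => fun x => powPotential G q σ ((E n).indicator (picardIterate G q σ f E w n)) x + f x

theorem picardIterate_monotone {q : ℝ} (hq0 : 0 < q) {σ : Measure Ω} {f : Ω → ℝ≥0∞}
    {E : ℕ → Set Ω} (hE : Monotone E) {w : Ω → ℝ≥0∞}
    (hw : ∀ x, w x ≤ powPotential G q σ ((E 0).indicator w) x + f x) :
    Monotone (picardIterate G q σ f E w) := by
  refine monotone_nat_of_le_succ fun n => ?_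
  induction n with
  | zero => exact hw
  | succ n ih =>
    intro x
    refine add_le_add (powPotential_mono_ae hq0 σ (.of_forall fun y => ?_) x) le_rfl
    exact (indicator_le_indicator (ih y)).trans
      (indicator_le_indicator_of_subset (hE n.le_succ) (fun _ => zero_le) y)

/-- Truncating to `E n` bounds the density, so the next potential is at most a multiple of `𝐆σ`. The
bounds depend on `n`; they serve only to give the finiteness needed for absorption. -/
theorem picardIterate_bounded {q : ℝ} (hq0 : 0 < q) {σ : Measure Ω} {f : Ω → ℝ≥0∞}
    {E : ℕ → Set Ω} {w : Ω → ℝ≥0∞}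
    (hE : ∀ n, ∃ M : ℝ≥0∞, M ≠ ∞ ∧ ∀ x ∈ E n, potential G σ x ≤ M ∧ f x ≤ M)
    (hw : ∀ m, ∃ M : ℝ≥0∞, M ≠ ∞ ∧ ∀ x ∈ E m, w x ≤ M) (n m : ℕ) :
    ∃ M : ℝ≥0∞, M ≠ ∞ ∧ ∀ x ∈ E m, picardIterate G q σ f E w n x ≤ M := by
  induction n generalizing m with
  | zero => exact hw m
  | succ n ih =>
    obtain ⟨M₁, hM₁, h₁⟩ := ih n
    obtain ⟨M₂, hM₂, h₂⟩ := hE m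
    have hM₁q : M₁ ^ q ≠ ∞ := ENNReal.rpow_ne_top_of_nonneg hq0.le hM₁
    refine ⟨M₁ ^ q * M₂ + M₂, ENNReal.add_ne_top.2 ⟨ENNReal.mul_ne_top hM₁q hM₂, hM₂⟩,
      fun x hx => add_le_add ?_ (h₂ x hx).2⟩
    have h3 := powPotential_mono_ae (G := G) hq0 σ
      (u := (E n).indicator (picardIterate G q σ f E w n)) (v := fun _ => M₁ * 1)
      (.of_forall fun y => by
        rw [mul_one]
        exact indicator_apply_le' (h₁ y) fun _ => zero_le) x
    rw [powPotential_const_mul hq0 σ hM₁] at h3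
    refine h3.trans (mul_le_mul_right ?_ _)
    simpa [powPotential] using (h₂ x hx).1

variable [TopologicalSpace Ω] [SecondCountableTopology Ω] [BorelSpace Ω]

theorem IsKernel.measurable_powPotential (hG : IsKernel G) (q : ℝ) (σ : Measure Ω) [SFinite σ]
    (u : Ω → ℝ≥0∞) : Measurable (powPotential G q σ u) :=
  hG.measurable_potential _

theorem IsKernel.measurable_picardIterate (hG : IsKernel G) (q : ℝ) (σ : Measure Ω) [SFinite σ]
    {f : Ω → ℝ≥0∞} (hf : Measurable f) (E : ℕ → Set Ω) {w : Ω → ℝ≥0∞} (hw : Measurable w) (n : ℕ) :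
    Measurable (picardIterate G q σ f E w n) := by
  cases n with
  | zero => exact hw
  | succ n => exact (hG.measurable_powPotential q σ _).add hf

theorem IsKernel.potential_pos (hG : IsKernel G) {ν : Measure Ω} (hν : ν univ ≠ 0) (x : Ω) :
    0 < potential G ν x := by
  rw [potential, lintegral_pos_iff_support (hG.measurable_apply x)]
  have : Function.support (G x) = univ := by
    ext y
    simp [(hG.pos x y).ne']
  rw [this]
  exact pos_iff_ne_zero.2 hν

/-- The supremum of the truncated iterates satisfies the equation. -/
theorem IsKernel.iSup_picardIterate_eq (hG : IsKernel G) {q : ℝ} (hq0 : 0 < q) (σ : Measure Ω)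
    [SFinite σ] {f : Ω → ℝ≥0∞} (hf : Measurable f) {E : ℕ → Set Ω}
    (hEm : ∀ n, MeasurableSet (E n)) (hE : Monotone E)
    (hEσ : ∀ᵐ x ∂σ, ∃ n, x ∈ E n) {w : Ω → ℝ≥0∞} (hwm : Measurable w)
    (hw : ∀ x, w x ≤ powPotential G q σ ((E 0).indicator w) x + f x) (x : Ω) :
    powPotential G q σ (fun y => ⨆ n, picardIterate G q σ f E w n y) x + f x =
      ⨆ n, picardIterate G q σ f E w n x := by
  set W := picardIterate G q σ f E w with hW
  have hmono : Monotone W := picardIterate_monotone hq0 hE hw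
  have hWm : ∀ n, Measurable (W n) := hG.measurable_picardIterate q σ hf E hwm
  have hIm : ∀ n, Measurable ((E n).indicator (W n)) := fun n => (hWm n).indicator (hEm n)
  have hImono : Monotone fun n => (E n).indicator (W n) := fun n m hnm y =>
    (indicator_le_indicator (hmono hnm y)).trans
      (indicator_le_indicator_of_subset (hE hnm) (fun _ => zero_le) y)
  have hsup : (⨆ n, W n x) = ⨆ n, W (n + 1) x :=
    (Monotone.iSup_nat_add (f := fun n => W n x) (fun n m h => hmono h x) 1).symm
  have hsucc : ∀ n, W (n + 1) x = powPotential G q σ ((E n).indicator (W n)) x + f x :=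
    fun n => rfl
  rw [hsup]
  simp_rw [hsucc]
  rw [← ENNReal.iSup_add]
  congr 1
  simp_rw [fun n => hG.powPotential_apply (q := q) σ (hIm n) x]
  rw [hG.powPotential_apply σ (Measurable.iSup hWm) x,
    ← lintegral_iSup (f := fun n y => G x y * (E n).indicator (W n) y ^ q)
      (fun n => (hG.measurable_apply x).mul ((hIm n).pow_const q))
      (fun n m hnm y => mul_le_mul_right (ENNReal.rpow_le_rpow (hImono hnm y) hq0.le) _)]
  refine lintegral_congr_ae ?_
  filter_upwards [hEσ] with y ⟨k, hk⟩
  -- The truncation disappears in the limit: `y` belongs to every `E n` with `n ≥ k`, and the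
  -- iterates increase.
  have h1 : (⨆ n, W n y) = ⨆ n, (E n).indicator (W n) y := by
    refine le_antisymm (iSup_le fun n => ?_) (iSup_mono fun n => indicator_le_self _ _ y)
    refine le_iSup_of_le (max n k) ?_
    rw [indicator_of_mem (hE (le_max_right n k) hk)]
    exact hmono (le_max_left n k) y
  have h2 : (⨆ n, (E n).indicator (W n) y) ^ q = ⨆ n, (E n).indicator (W n) y ^ q :=
    (ENNReal.orderIsoRpow q hq0).map_iSup _
  rw [h1, h2, ENNReal.mul_iSup]

/-- Small multiples of a power of the potential of `σ|E` satisfy the subsolution inequality. -/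
theorem IsQuasiMetricKernel.exists_const_subsolution (hG : IsQuasiMetricKernel G κ)
    (hκ : 0 < κ) {q : ℝ} (hq0 : 0 < q) (hq1 : q < 1) (σ : Measure Ω) [SFinite σ]
    {E : Set Ω} (hE : MeasurableSet E) :
    ∃ c : ℝ≥0∞, c ≠ 0 ∧ c ≠ ∞ ∧ ∀ x, c * potential G (σ.restrict E) x ^ (1 / (1 - q)) ≤
      powPotential G q σ
        (E.indicator fun y => c * potential G (σ.restrict E) y ^ (1 / (1 - q))) x := by
  have h1q : 0 < 1 - q := by linarith
  have hp : 0 < q / (1 - q) := by positivity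
  set p := q / (1 - q) with hpdef
  have hs : 1 / (1 - q) = 1 + p := by rw [hpdef]; field_simp; ring
  set D : ℝ≥0∞ := 2 ^ (1 + p) * (2 * κ) ^ p with hD
  have hc0 : (2 * κ : ℝ≥0∞) ≠ 0 := by simp [hκ.ne']
  have hc : (2 * κ : ℝ≥0∞) ≠ ∞ := ENNReal.mul_ne_top (by simp) (by simp)
  have hD0 : D ≠ 0 := mul_ne_zero (by simp)
    (mt (ENNReal.rpow_eq_zero_iff_of_pos hp).1 hc0)
  have hDtop : D ≠ ∞ := ENNReal.mul_ne_top
    (ENNReal.rpow_ne_top_of_nonneg (by positivity) (by simp))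
    (ENNReal.rpow_ne_top_of_nonneg hp.le hc)
  -- The solution of `c * D = c ^ q`, balancing the two homogeneities.
  set c : ℝ≥0∞ := D⁻¹ ^ (1 / (1 - q)) with hcdef
  have hs0 : 0 < 1 / (1 - q) := by positivity
  have hcne0 : c ≠ 0 :=
    mt (ENNReal.rpow_eq_zero_iff_of_pos hs0).1 (ENNReal.inv_ne_zero.2 hDtop)
  have hcnetop : c ≠ ∞ := ENNReal.rpow_ne_top_of_nonneg hs0.le (ENNReal.inv_ne_top.2 hD0)
  have hcD : c * D = c ^ q := by
    have h1 : c ^ (1 - q) = D⁻¹ := by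
      rw [hcdef, ← ENNReal.rpow_mul, one_div, inv_mul_cancel₀ h1q.ne', ENNReal.rpow_one]
    have h2 : c = c ^ q * c ^ (1 - q) := by
      rw [← ENNReal.rpow_add_of_nonneg _ _ hq0.le h1q.le]
      simp
    conv_lhs => rw [h2]
    rw [h1, mul_assoc, ENNReal.inv_mul_cancel hD0 hDtop, mul_one]
  refine ⟨c, hcne0, hcnetop, fun x => ?_⟩
  set P := potential G (σ.restrict E) with hP
  have hPm : Measurable P := hG.measurable_potential _
  have hwm : Measurable fun y => c * P y ^ (1 / (1 - q)) := (hPm.pow_const _).const_mul _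
  have heq : powPotential G q σ (E.indicator fun y => c * P y ^ (1 / (1 - q))) x
      = c ^ q * ∫⁻ y, G x y * P y ^ p ∂(σ.restrict E) := by
    rw [hG.powPotential_apply σ (hwm.indicator hE),
      ← lintegral_const_mul' _ _ (ENNReal.rpow_ne_top_of_nonneg hq0.le hcnetop),
      ← lintegral_indicator hE]
    refine lintegral_congr fun y => ?_
    by_cases hy : y ∈ E
    · rw [indicator_of_mem hy, indicator_of_mem hy, ENNReal.mul_rpow_of_nonneg _ _ hq0.le,
        ← ENNReal.rpow_mul (P y), one_div_mul_eq_div]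
      ring
    · rw [indicator_of_notMem hy, indicator_of_notMem hy, ENNReal.zero_rpow_of_pos hq0, mul_zero]
  rw [heq, ← hcD, hs, mul_assoc]
  exact mul_le_mul_right (hG.potential_rpow_le hκ hp (σ.restrict E) x) _

/-- Exhaustion of the space by sets on which `𝐆σ` and `f` are bounded. -/
theorem IsKernel.exists_exhaustion (hG : IsKernel G) (σ : Measure Ω) [SFinite σ] (hσ : σ ≠ 0)
    {f : Ω → ℝ≥0∞} (hf : Measurable f) (hGσ : ∀ᵐ x ∂σ, potential G σ x < ∞)
    (hftop : ∀ᵐ x ∂σ, f x < ∞) :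
    ∃ E : ℕ → Set Ω, (∀ n, MeasurableSet (E n)) ∧ Monotone E ∧ (∀ᵐ x ∂σ, ∃ n, x ∈ E n) ∧
      (∀ n, ∃ M : ℝ≥0∞, M ≠ ∞ ∧ ∀ x ∈ E n, potential G σ x ≤ M ∧ f x ≤ M) ∧ σ (E 0) ≠ 0 := by
  set E : ℕ → Set Ω := fun n => {x | max (potential G σ x) (f x) ≤ n} with hE
  have hEm : ∀ n, MeasurableSet (E n) := fun n =>
    measurableSet_le ((hG.measurable_potential σ).max hf) measurable_const
  have hmono : Monotone E := fun n m hnm x (hx : _ ≤ (n : ℝ≥0∞)) =>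
    hx.trans (by exact_mod_cast hnm)
  have hex : ∀ᵐ x ∂σ, ∃ n, x ∈ E n := by
    filter_upwards [hGσ, hftop] with x h1 h2
    obtain ⟨n, hn⟩ := ENNReal.exists_nat_gt (max_lt h1 h2).ne
    exact ⟨n, hn.le⟩
  obtain ⟨N, hN⟩ : ∃ N, σ (E N) ≠ 0 := by
    by_contra! h
    refine hσ (Measure.measure_univ_eq_zero.1 ?_)
    rw [← compl_empty, ← mem_ae_iff]
    have h1 : ∀ᵐ x ∂σ, ∀ n, x ∉ E n := ae_all_iff.2 fun n => measure_eq_zero_iff_ae_notMem.1 (h n)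
    filter_upwards [h1, hex] with x hx ⟨n, hn⟩
    exact hx n hn
  -- The shift gives the first set positive measure, so that the initial iterate built on it is
  -- positive.
  refine ⟨fun n => E (n + N), fun n => hEm _, fun n m h => hmono (by omega), ?_, fun n => ?_, ?_⟩
  · filter_upwards [hex] with x ⟨n, hn⟩
    exact ⟨n, hmono (by omega) hn⟩
  · refine ⟨((n + N : ℕ) : ℝ≥0∞), by simp, fun x hx => ?_⟩
    exact max_le_iff.1 hx
  · simpa using hN

theorem IsQuasiMetricKernel.exists_solution (hG : IsQuasiMetricKernel G κ)
    (hκ : 0 < κ) {q : ℝ} (hq0 : 0 < q) (hq1 : q < 1) (σ : Measure Ω) [SFinite σ] (hσ : σ ≠ 0)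
    {f : Ω → ℝ≥0∞} (hf : Measurable f) (hGσ : ∀ᵐ x ∂σ, potential G σ x < ∞)
    (hK : ∀ᵐ x ∂σ, nonlinearPotential G q σ x < ∞) (hftop : ∀ᵐ x ∂σ, f x < ∞)
    (hGf : ∀ᵐ x ∂σ, powPotential G q σ f x < ∞) :
    ∃ u : Ω → ℝ≥0∞, IsNontrivialSolution G q σ f u := by
  have h1q : 0 < 1 - q := by linarith
  have hs0 : 0 < 1 / (1 - q) := by positivity
  obtain ⟨E, hEm, hE, hEσ, hEb, hE0⟩ := hG.exists_exhaustion σ hσ hf hGσ hftop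
  obtain ⟨c, hc0, hc, hsub⟩ := hG.exists_const_subsolution hκ hq0 hq1 σ (hEm 0)
  set w : Ω → ℝ≥0∞ := fun x => c * potential G (σ.restrict (E 0)) x ^ (1 / (1 - q)) with hw
  have hwm : Measurable w := ((hG.measurable_potential _).pow_const _).const_mul _
  have hw1 : ∀ x, w x ≤ powPotential G q σ ((E 0).indicator w) x + f x :=
    fun x => (hsub x).trans le_self_add
  have hwpos : ∀ x, 0 < w x := by
    intro x
    have h1 : 0 < potential G (σ.restrict (E 0)) x :=
      hG.potential_pos (by rwa [Measure.restrict_apply_univ]) x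
    exact pos_iff_ne_zero.2
      (mul_ne_zero hc0 (mt (ENNReal.rpow_eq_zero_iff_of_pos hs0).1 h1.ne'))
  have hwb : ∀ m, ∃ M : ℝ≥0∞, M ≠ ∞ ∧ ∀ x ∈ E m, w x ≤ M := by
    intro m
    obtain ⟨M, hM, h⟩ := hEb m
    refine ⟨c * M ^ (1 / (1 - q)),
      ENNReal.mul_ne_top hc (ENNReal.rpow_ne_top_of_nonneg hs0.le hM), fun x hx => ?_⟩
    refine mul_le_mul_right (ENNReal.rpow_le_rpow ?_ hs0.le) _
    exact (potential_mono Measure.restrict_le_self x).trans (h x hx).1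
  set W := picardIterate G q σ f E w with hW
  have hmono : Monotone W := picardIterate_monotone hq0 hE hw1
  have hWm : ∀ n, Measurable (W n) := hG.measurable_picardIterate q σ hf E hwm
  -- Monotonicity makes the truncated `W n` satisfy the subsolution inequality, so the a priori
  -- bound holds uniformly in `n`.
  have hbound : ∀ n m x, x ∈ E m → W (n + 1) x ≤ upperConst q κ * boundFun G q σ f x + f x := by
    intro n m x hx
    refine add_le_add (hG.powPotential_le_boundFun hκ hq0 hq1 σ (.of_forall fun y => ?_) ?_) le_rfl
    · exact indicator_apply_le' (fun _ => hmono n.le_succ y) fun _ => zero_le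
    · obtain ⟨M, hM, h⟩ := picardIterate_bounded hq0 hEb hwb (n + 1) m
      exact ne_top_of_le_ne_top hM (le_self_add.trans (h x hx))
  have heq := hG.iSup_picardIterate_eq hq0 σ hf hEm hE hEσ hwm hw1
  have htop : ∀ᵐ x ∂σ, (⨆ n, W n x) < ∞ := by
    filter_upwards [hEσ, hGσ, hK, hftop, hGf] with x ⟨m, hm⟩ h1 h2 h3 h4
    have h5 : upperConst q κ * boundFun G q σ f x + f x < ∞ := by
      refine ENNReal.add_lt_top.2 ⟨ENNReal.mul_lt_top (upperConst_ne_top hq0 hq1 κ).lt_top ?_, h3⟩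
      exact ENNReal.add_lt_top.2 ⟨ENNReal.add_lt_top.2
        ⟨ENNReal.rpow_lt_top_of_nonneg hs0.le h1.ne, h2⟩, h4⟩
    refine lt_of_le_of_lt (iSup_le fun n => ?_) h5
    exact (hmono n.le_succ x).trans (hbound n m x hm)
  have hm : Measurable fun x => ⨆ n, W n x := Measurable.iSup hWm
  refine ⟨fun x => ⨆ n, W n x, ⟨hm, ?_, ?_, htop⟩, ⟨hm, ?_, ?_⟩⟩
  · exact .of_forall fun x => (hwpos x).trans_le (le_iSup (fun n => W n x) 0)
  · exact .of_forall fun x => (heq x).le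
  · exact .of_forall fun x => (heq x).ge
  · filter_upwards [htop] with x hx
    rwa [heq x]

/-- The reciprocal of the constant in the lower bound of supersolutions. -/
noncomputable def lowerConstInv (q : ℝ) (κ : ℝ≥0) : ℝ≥0∞ :=
  ((2 * κ) ^ q * weakConst q) ^ (1 / (1 - q)) + capacityConst q κ + 1

theorem lowerConstInv_ne_top {q : ℝ} (hq0 : 0 < q) (hq1 : q < 1) (κ : ℝ≥0) :
    lowerConstInv q κ ≠ ∞ := by
  have h1q : 0 < 1 - q := by linarith
  have hc : (2 * κ : ℝ≥0∞) ≠ ∞ := ENNReal.mul_ne_top (by simp) (by simp)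
  refine ENNReal.add_ne_top.2 ⟨ENNReal.add_ne_top.2
    ⟨ENNReal.rpow_ne_top_of_nonneg (by positivity) ?_, capacityConst_ne_top hq0 hq1 κ⟩, by simp⟩
  exact ENNReal.mul_ne_top (ENNReal.rpow_ne_top_of_nonneg hq0.le hc) (weakConst_ne_top hq1)

theorem IsQuasiMetricKernel.boundFun_le (hG : IsQuasiMetricKernel G κ)
    (hκ : 0 < κ) {q : ℝ} (hq0 : 0 < q) (hq1 : q < 1) (σ : Measure Ω) [SFinite σ]
    {f u : Ω → ℝ≥0∞} (hu : IsNontrivialSupersolution G q σ f u) (x : Ω) :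
    boundFun G q σ f x ≤ lowerConstInv q κ * powPotential G q σ u x := by
  have h1q : 0 < 1 - q := by linarith
  have hle : ∀ᵐ x ∂σ, powPotential G q σ u x ≤ u x := by
    filter_upwards [hu.le] with x hx using le_self_add.trans hx
  have hfu : ∀ᵐ x ∂σ, f x ≤ u x := by
    filter_upwards [hu.le] with x hx using le_add_self.trans hx
  have h1 := ENNReal.rpow_le_rpow (hG.potential_le_of_supersolution hκ hq0 hq1 σ hu.measurable
    hu.pos hu.lt_top hle x) (by positivity : 0 ≤ 1 / (1 - q))
  rw [ENNReal.mul_rpow_of_nonneg _ (_ ^ _) (by positivity), ← ENNReal.rpow_mul _ (1 - q),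
    mul_one_div_cancel h1q.ne', ENNReal.rpow_one] at h1
  rw [boundFun, lowerConstInv, add_mul, add_mul, one_mul]
  exact add_le_add (add_le_add h1
    (hG.nonlinearPotential_le hκ hq0 hq1 σ hu.measurable hu.pos hu.lt_top hle x))
    (powPotential_mono_ae hq0 σ hfu x)

theorem IsQuasiMetricKernel.lowerBound (hG : IsQuasiMetricKernel G κ)
    (hκ : 0 < κ) {q : ℝ} (hq0 : 0 < q) (hq1 : q < 1) (σ : Measure Ω) [SFinite σ]
    {f u : Ω → ℝ≥0∞} (hu : IsNontrivialSupersolution G q σ f u) :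
    LowerBound G q σ f u (lowerConstInv q κ)⁻¹.toNNReal := by
  have h0 : lowerConstInv q κ ≠ 0 := by simp [lowerConstInv]
  have htop := lowerConstInv_ne_top hq0 hq1 κ
  filter_upwards [hu.le] with x hx
  rw [ENNReal.coe_toNNReal (ENNReal.inv_ne_top.2 h0)]
  refine le_trans (add_le_add ?_ le_rfl) hx
  calc _ ≤ (lowerConstInv q κ)⁻¹ * (lowerConstInv q κ * powPotential G q σ u x) :=
        mul_le_mul_right (hG.boundFun_le hκ hq0 hq1 σ hu x) _
    _ = _ := by rw [← mul_assoc, ENNReal.inv_mul_cancel h0 htop, one_mul]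

theorem IsQuasiMetricKernel.upperBound (hG : IsQuasiMetricKernel G κ)
    (hκ : 0 < κ) {q : ℝ} (hq0 : 0 < q) (hq1 : q < 1) (σ : Measure Ω) [SFinite σ]
    {f u : Ω → ℝ≥0∞} (hu : IsSubsolution G q σ f u) :
    UpperBound G q σ f u (upperConst q κ).toNNReal := by
  filter_upwards [hu.le, hu.lt_top] with x hx htop
  rw [ENNReal.coe_toNNReal (upperConst_ne_top hq0 hq1 κ)]
  refine hx.trans (add_le_add (hG.powPotential_le_boundFun hκ hq0 hq1 σ hu.le ?_) le_rfl)
  exact (le_self_add.trans_lt htop).ne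

/-- Both functions are compared with the same `boundFun`, so their ratio is bounded and the
iteration in `le_of_le_const_mul` applies. -/
theorem IsQuasiMetricKernel.subsolution_le_supersolution (hG : IsQuasiMetricKernel G κ)
    (hκ : 0 < κ) {q : ℝ} (hq0 : 0 < q) (hq1 : q < 1) (σ : Measure Ω) [SFinite σ]
    {f u v : Ω → ℝ≥0∞} (hu : IsSubsolution G q σ f u) (hv : IsNontrivialSupersolution G q σ f v) :
    ∀ᵐ x ∂σ, u x ≤ v x := by
  -- The summand `1` accounts for `f ≤ v` and ensures `a ≥ 1`.
  set a : ℝ≥0∞ := upperConst q κ * lowerConstInv q κ + 1 with ha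
  have hatop : a ≠ ∞ := ENNReal.add_ne_top.2 ⟨ENNReal.mul_ne_top (upperConst_ne_top hq0 hq1 κ)
    (lowerConstInv_ne_top hq0 hq1 κ), by simp⟩
  refine le_of_le_const_mul (a := a.toReal) hq0 hq1 σ hu.le hv.le ?_ ?_
  · rw [← ENNReal.toReal_one]
    exact ENNReal.toReal_mono hatop le_add_self
  · rw [ENNReal.ofReal_toReal hatop]
    filter_upwards [hG.upperBound hκ hq0 hq1 σ hu, hv.le] with x h1 h2
    rw [ENNReal.coe_toNNReal (upperConst_ne_top hq0 hq1 κ)] at h1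
    calc u x ≤ upperConst q κ * (lowerConstInv q κ * powPotential G q σ v x) + f x :=
          h1.trans (add_le_add (mul_le_mul_right (hG.boundFun_le hκ hq0 hq1 σ hv x) _) le_rfl)
      _ ≤ upperConst q κ * (lowerConstInv q κ * v x) + v x := by
          gcongr
          · exact le_self_add.trans h2
          · exact le_add_self.trans h2
      _ = a * v x := by rw [ha]; ring

end Solutions

end SublinearPotential

theorem theorem6p1 (q : ℝ) (hq0 : 0 < q) (hq1 : q < 1) (κ : ℝ≥0) (hκ : 0 < κ) :
    ∃ c C : ℝ≥0, 0 < c ∧ 0 < C ∧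
      ∀ (Ω : Type*) [TopologicalSpace Ω] [LocallyCompactSpace Ω] [T2Space Ω]
        [SecondCountableTopology Ω] [MeasurableSpace Ω] [BorelSpace Ω]
        (G : Ω → Ω → ℝ≥0∞) (_ : IsQuasiMetricKernel G κ)
        (σ : Measure Ω) [IsLocallyFiniteMeasure σ] (_ : σ ≠ 0)
        (f : Ω → ℝ≥0∞) (_ : Measurable f),
        -- (i) uniqueness and bilateral estimates for nontrivial solutions
        ((∀ u v : Ω → ℝ≥0∞, IsNontrivialSolution G q σ f u → IsNontrivialSolution G q σ f v →
            u =ᵐ[σ] v) ∧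
          (∀ u : Ω → ℝ≥0∞, IsNontrivialSolution G q σ f u →
            LowerBound G q σ f u c ∧ UpperBound G q σ f u C)) ∧
        -- (ii) one-sided estimates for supersolutions and subsolutions
        ((∀ u : Ω → ℝ≥0∞, IsNontrivialSupersolution G q σ f u → LowerBound G q σ f u c) ∧
          (∀ u : Ω → ℝ≥0∞, IsSubsolution G q σ f u → UpperBound G q σ f u C)) ∧
        -- (iii) the existence criterion
        ((∃ u : Ω → ℝ≥0∞, IsNontrivialSolution G q σ f u) ↔
          (∀ᵐ x ∂σ, potential G σ x < ∞) ∧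
          (∀ᵐ x ∂σ, nonlinearPotential G q σ x < ∞) ∧
          (∀ᵐ x ∂σ, f x < ∞) ∧
          (∀ᵐ x ∂σ, powPotential G q σ f x < ∞)) := by
  refine ⟨(lowerConstInv q κ)⁻¹.toNNReal, (upperConst q κ).toNNReal, ?_, ?_, ?_⟩
  · refine ENNReal.toNNReal_pos (ENNReal.inv_ne_zero.2 (lowerConstInv_ne_top hq0 hq1 κ)) ?_
    simp [lowerConstInv]
  · refine ENNReal.toNNReal_pos ?_ (upperConst_ne_top hq0 hq1 κ)
    simp [upperConst]
  intro Ω _ _ _ _ _ _ G hG σ _ hσ f hf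
  have h1q : 0 < 1 - q := by linarith
  refine ⟨⟨fun u v hu hv => ?_, fun u hu => ⟨hG.lowerBound hκ hq0 hq1 σ hu.1,
    hG.upperBound hκ hq0 hq1 σ hu.2⟩⟩, ⟨fun u hu => hG.lowerBound hκ hq0 hq1 σ hu,
    fun u hu => hG.upperBound hκ hq0 hq1 σ hu⟩, ⟨?_, ?_⟩⟩
  · filter_upwards [hG.subsolution_le_supersolution hκ hq0 hq1 σ hu.2 hv.1,
      hG.subsolution_le_supersolution hκ hq0 hq1 σ hv.2 hu.1] with x h1 h2
    exact le_antisymm h1 h2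
  · rintro ⟨u, hu, -⟩
    -- Necessity: a finite supersolution dominates a positive multiple of every summand of
    -- `boundFun`.
    have hb : ∀ᵐ x ∂σ, boundFun G q σ f x < ∞ := by
      filter_upwards [hu.le, hu.lt_top] with x h1 h2
      refine (hG.boundFun_le hκ hq0 hq1 σ hu x).trans_lt ?_
      exact ENNReal.mul_lt_top (lowerConstInv_ne_top hq0 hq1 κ).lt_top
        ((le_self_add.trans h1).trans_lt h2)
    refine ⟨?_, ?_, ?_, ?_⟩
    · filter_upwards [hb] with x hx
      have h2 := (ENNReal.add_lt_top.1 (ENNReal.add_lt_top.1 hx).1).1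
      exact (ENNReal.rpow_lt_top_iff_of_pos (by positivity)).1 h2
    · filter_upwards [hb] with x hx using (ENNReal.add_lt_top.1 (ENNReal.add_lt_top.1 hx).1).2
    · filter_upwards [hu.le, hu.lt_top] with x h1 h2 using (le_add_self.trans h1).trans_lt h2
    · filter_upwards [hb] with x hx using (ENNReal.add_lt_top.1 hx).2
  · rintro ⟨h1, h2, h3, h4⟩
    exact hG.exists_solution hκ hq0 hq1 σ hσ hf h1 h2 h3 h4
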